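/- **Setting.** Let $A$ be a finite set of actions with a target action $a^*$, let $X$ be a measurable space of signals (e.g. a subset of a Euclidean space with its Borel sets), and let $(\mu_a)_{a\in A}$ be pairwise distinct, mutually absolutely continuous probability measures on $X$ with $\int (d\mu_{a'}/d\mu_a)^{\lambda}\,d\mu_a<\infty$ for all $a,a'$ and all $\lambda>0$. Let $\underline w\in\mathbb R$, let $u:[\underline w,\infty)\to\mathbb R$ be $C^2$ with $u'>0$, $u''<0$ and $\lim_{w\to\infty}u'(w)=0$, put $h=u^{-1}$, and let $c:A\to\mathbb R$ satisfy $c(A)\subseteq \mathrm{int}\,u([\underline w,\infty))$, $c(a)<c(a^*)$ for some $a$, and $c(a)\ne c(a^*)$ for all $a\neq a^*$. Let $A^-=\{a: c(a)<c(a^*)\}$. Write $\mathbb P_a,\mathbb E_a$ for the law of, and the expectation over, $n$ i.i.d. draws $x^n=(x_1,\dots,x_n)$ from $\mu_a$. An optimal contract with $n$ signals is a measurable $v:X^n\to u([\underline w,\infty))$ that minimizes $\mathbb E_{a^*}[h(v(x^n))]$ (finite) subject to $\mathbb E_{a^*}[v]-c(a^*)\ge \mathbb E_a[v]-c(a)$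 for all $a\in A$ and $\mathbb E_{a^*}[v]-c(a^*)\ge 0$. **Contracts as functions of scores.** Let $\ell(x)=(\log\frac{d\mu_{a^*}}{d\mu_a}(x))_{a\ne a^*}$ and let $L_n=\frac1n\sum_{i=1}^n \ell(x_i)\in\mathbb R^{A\setminus\{a^*\}}$ be the vector of log-likelihood scores. Let $D$ be the closed convex hull of the support of the law of $\ell$ under $\mu_{a^*}$, and let $\rho$ be any $\sigma$-finite Borel measure on $\mathbb R^{A\setminus\{a^*\}}$ with support $D$. Let $v_n^*:\mathbb R^{A\setminus\{a^*\}}\to\mathbb R$ be functions such that for all large $n$ the contract $x^n\mapsto v^*_n(L_n(x^n))$ is optimal. At scores that are not realized with $n$ signals, $v_n^*$ is only required to interpolate asymptotically: for $\rho$-almost every $L$, every $\varepsilon>0$ and all large $n$, each of the events $\{\max_a|L_n(a)-L(a)|<\varepsilon,\ v_n^*(L_n)<v_n^*(L)+\varepsilon\}$ and $\{\max_a|L_n(a)-L(a)|<\varepsilon,\ v_n^*(L_n)>v_n^*(L)-\varepsilon\}$ has positive probability under $\mathbb P_{a^*}$. **Claim.** If $(v_n^*)$ converges weakly in $L^2(\rho)$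 to $v_\infty$, then there is $\gamma:A\setminus\{a^*\}\to[-\infty,\infty)$, with $\gamma(a)=-\infty$ whenever $c(a)>c(a^*)$, such that for $\rho$-almost every $L$ $$\lim_{n\to\infty}v_n^*(L)=v_\infty(L)=\begin{cases} c(a^*) & \text{if } L(a)>\gamma(a)\text{ for every } a\ne a^*,\\ u(\underline w) & \text{if } L(a)<\gamma(a)\text{ for some } a\neq a^*,\end{cases}$$ and such that, for every $\hat a\in\operatorname{argmin}_{a\in A^-}\mathrm{KL}(\mu_a,\mu_{a^*})$, the threshold is maximally lenient: $\gamma(\hat a)=\mathbb E_{\hat a}[L_n(\hat a)]$ (which does not depend on $n\ge1$). -/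

import Mathlib

open Set Filter Topology MeasureTheory

/-- A moral hazard environment: signal distributions `μ a`, the lower bound `wmin` on wages, the
consumption utility `u` (relevant on `[wmin, ∞)` only), action costs `c` and the target action. -/
structure MoralHazard (A X : Type*) [MeasurableSpace X] where
  μ : A → Measure X
  wmin : ℝ
  u : ℝ → ℝ
  c : A → ℝ
  target : A

namespace MoralHazard

/-- The standing assumptions on the monitoring technology and on payoffs. Derivatives on
`[wmin, ∞)` are one-sided at `wmin`. -/
structure Assumptions {A X : Type*} [MeasurableSpace X] (M : MoralHazard A X) : Prop where
  isProbabilityMeasure : ∀ a, IsProbabilityMeasure (M.μ a)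
  identified : ∀ a a', a ≠ a' → M.μ a ≠ M.μ a'
  absolutelyContinuous : ∀ a a', M.μ a' ≪ M.μ a
  mgf_finite : ∀ a a', ∀ t : ℝ, 0 < t → ∫⁻ x, ((M.μ a').rnDeriv (M.μ a) x) ^ t ∂(M.μ a) < ⊤
  u_contDiffOn : ContDiffOn ℝ 2 M.u (Ici M.wmin)
  u_deriv_pos : ∀ w ∈ Ici M.wmin, 0 < derivWithin M.u (Ici M.wmin) w
  u_deriv2_neg : ∀ w ∈ Ici M.wmin,
    derivWithin (derivWithin M.u (Ici M.wmin)) (Ici M.wmin) w < 0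
  u_deriv_tendsto : Tendsto (derivWithin M.u (Ici M.wmin)) atTop (𝓝 0)
  cost_mem_interior : ∀ a, M.c a ∈ interior (M.u '' Ici M.wmin)
  exists_cheaper : ∃ a, M.c a < M.c M.target
  cost_ne : ∀ a, a ≠ M.target → M.c a ≠ M.c M.target

/-- The law of `n` i.i.d. signals when action `a` is chosen. -/
noncomputable def law {A X : Type*} [MeasurableSpace X] (M : MoralHazard A X) (n : ℕ) (a : A) :
    Measure (Fin n → X) :=
  Measure.pi fun _ => M.μ a

/-- The inverse `h` of the utility function on `u([wmin, ∞))`. -/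
noncomputable def h {A X : Type*} [MeasurableSpace X] (M : MoralHazard A X) : ℝ → ℝ :=
  Function.invFunOn M.u (Ici M.wmin)

/-- The principal's expected wage payment under the utility contract `v`. -/
noncomputable def cost {A X : Type*} [MeasurableSpace X] (M : MoralHazard A X) {n : ℕ}
    (v : (Fin n → X) → ℝ) : ℝ :=
  ∫ x, M.h (v x) ∂(M.law n M.target)

/-- `v` is a contract in utility terms, with finite expected utilities and finite expected cost,
that satisfies incentive compatibility and individual rationality. -/
structure Feasible {A X : Type*} [MeasurableSpace X] (M : MoralHazard A X) {n : ℕ}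
    (v : (Fin n → X) → ℝ) : Prop where
  measurable : Measurable v
  range : ∀ x, v x ∈ M.u '' Ici M.wmin
  integrable : ∀ a, Integrable v (M.law n a)
  integrable_cost : Integrable (fun x => M.h (v x)) (M.law n M.target)
  ic : ∀ a, ∫ x, v x ∂(M.law n a) - M.c a ≤ ∫ x, v x ∂(M.law n M.target) - M.c M.target
  ir : 0 ≤ ∫ x, v x ∂(M.law n M.target) - M.c M.target

/-- `v` solves the second-best problem with `n` signals. -/
def IsOptimal {A X : Type*} [MeasurableSpace X] (M : MoralHazard A X) {n : ℕ}
    (v : (Fin n → X) → ℝ) : Prop :=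
  M.Feasible v ∧ ∀ v' : (Fin n → X) → ℝ, M.Feasible v' → M.cost v ≤ M.cost v'

/-- Deviations: the actions other than the target action. -/
abbrev Deviation {A X : Type*} [MeasurableSpace X] (M : MoralHazard A X) : Type _ :=
  {a : A // a ≠ M.target}

/-- The space in which vectors of log-likelihood scores live. -/
abbrev Score {A X : Type*} [MeasurableSpace X] (M : MoralHazard A X) : Type _ :=
  M.Deviation → ℝ

/-- The vector of log-likelihood ratios of the target action against each deviation, at one
signal. -/
noncomputable def logRatio {A X : Type*} [MeasurableSpace X] (M : MoralHazard A X) (x : X) :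
    M.Score :=
  fun a => llr (M.μ M.target) (M.μ a) x

/-- The log-likelihood score vector `L_n`: the average of the log-likelihood ratios. -/
noncomputable def score {A X : Type*} [MeasurableSpace X] (M : MoralHazard A X) (n : ℕ)
    (x : Fin n → X) : M.Score :=
  fun a => (1 / (n : ℝ)) * ∑ i, M.logRatio (x i) a

/-- The domain of scores: the closed convex hull of the essential range of the log-likelihood
ratio vector. The essential range is the support of the law of that vector; it does not depend
on the versions of the densities. -/
noncomputable def scoreDomain {A X : Type*} [MeasurableSpace X] (M : MoralHazard A X) :
    Set M.Score :=
  closure (convexHull ℝ ((M.μ M.target).map M.logRatio).support)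

/-- The functions `v n` of scores assign to almost every score `L`, asymptotically, a value
between values which the contract `x ↦ v n (L_n x)` takes at signal sequences whose score is
close to `L`: for every `ε > 0` and all large `n`, with positive probability the score is
`ε`-close to `L` and the payment is below `v n L + ε`, and likewise above `v n L - ε`.
This only matters at scores which are not realized with `n` signals. -/
def Interpolates {A X : Type*} [MeasurableSpace X] (M : MoralHazard A X) (ρ : Measure M.Score)
    (v : ℕ → M.Score → ℝ) : Prop :=
  ∀ᵐ L ∂ρ, ∀ ε : ℝ, 0 < ε → ∀ᶠ n in atTop,
    (∃ᵐ x ∂(M.law n M.target),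
      (∀ a, |M.score n x a - L a| < ε) ∧ v n (M.score n x) < v n L + ε) ∧
    (∃ᵐ x ∂(M.law n M.target),
      (∀ a, |M.score n x a - L a| < ε) ∧ v n L - ε < v n (M.score n x))

end MoralHazard

/-- Weak convergence in `L²(ρ)` of the sequence `v` to `V`. -/
def WeaklyConvergesL2 {S : Type*} [MeasurableSpace S] (ρ : Measure S) (v : ℕ → S → ℝ)
    (V : S → ℝ) : Prop :=
  (∀ᶠ n in atTop, MemLp (v n) 2 ρ) ∧ MemLp V 2 ρ ∧
    ∀ g : S → ℝ, MemLp g 2 ρ →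
      Tendsto (fun n => ∫ s, v n s * g s ∂ρ) atTop (𝓝 (∫ s, V s * g s ∂ρ))

/-! Lagrangian duality under Slater's condition gives nonnegative multipliers `l n` such that the
optimal contract minimizes `h t - y * t` pointwise, where at score `L` the shadow value is `y = ∑ a,
l n a - ∑_{a ≠ a*} l n a * exp (-n L a)` (`ae_eq_bestUtility`). Test contracts show that the
multipliers of the deviations vanish, while the total approaches `h'(c(a*))`. Along a subsequence
the multipliers have exponential rates `γ a ≤ 0`. If `L` exceeds `γ` in every coordinate, the
exponential terms die out and the payment tends to `c(a*)`; if `L` falls below `γ` in some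
coordinate, `y` becomes nonpositive and the payment is `u(wmin)`.

Weak convergence removes the dependence on the subsequence. The weak limit is a single function that
must agree with the pointwise limit along each subsequence, so an open overlap of one reward region
with another punishment region would have to be null. As `ρ` has full support in the convex set `D`,
no such overlap meets `D`, and moving slightly inside `D` upgrades weak inequalities to strict ones.

Leniency is a large deviation argument. Let `k` be the least divergence `KL(μ_a, μ_{a*})` among
cheaper actions. A two-level contract that punishes scores typical of some cheaper action costs at
most about `exp (-n k)` above the first best, so by strict convexity of `h` the optimal contract
punishes with at most about that probability (`exists_law_le`). By a change of measure, a signal law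
`ν` with finite second moments of its log-density and scores, whose mean score is strictly inside
the punishment region, has `KL(ν, μ_{a*}) ≥ k` (`le_integral_of_mean_lt`). A minimizer `â` has
divergence exactly `k`, and incentive compatibility puts its mean score in the closed punishment
region (`exists_meanScore_le`). Small reweightings of `μ_â` that bring it closer to `μ_{a*}` must
therefore have mean scores outside the open region. This yields `γ â ≤ E_â[L(â)]`, and that every
score in `D` with `L(â) < E_â[L(â)]` is already punished, possibly through another coordinate.
Raising `γ â` to `E_â[L(â)]` then changes nothing on `D`. -/

namespace MoralHazard

/-! ### The inverse utility `h`, its convexity and the pointwise cost minimizer. -/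

section Utility

variable {A X : Type*} [MeasurableSpace X] {M : MoralHazard A X}

/-- The set of attainable utility levels. -/
def utilities (M : MoralHazard A X) : Set ℝ := M.u '' Ici M.wmin

/-- The marginal cost `h'` of utility. -/
noncomputable def marginalCost (M : MoralHazard A X) (t : ℝ) : ℝ :=
  (derivWithin M.u (Ici M.wmin) (M.h t))⁻¹

/-- The utility level which minimizes `h t - y * t`. -/
noncomputable def bestUtility (M : MoralHazard A X) (y : ℝ) : ℝ :=
  Classical.epsilon fun t => t ∈ M.utilities ∧
    ∀ s ∈ M.utilities, s ≠ t → M.h t - y * t < M.h s - y * s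

theorem Assumptions.continuousOn_u (hM : M.Assumptions) : ContinuousOn M.u (Ici M.wmin) :=
  hM.u_contDiffOn.continuousOn

theorem Assumptions.continuousOn_derivWithin (hM : M.Assumptions) :
    ContinuousOn (derivWithin M.u (Ici M.wmin)) (Ici M.wmin) :=
  hM.u_contDiffOn.continuousOn_derivWithin (uniqueDiffOn_Ici _) (by norm_num)

theorem Assumptions.strictAntiOn_derivWithin (hM : M.Assumptions) :
    StrictAntiOn (derivWithin M.u (Ici M.wmin)) (Ici M.wmin) := by
  refine strictAntiOn_of_deriv_neg (convex_Ici _) hM.continuousOn_derivWithin fun x hx => ?_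
  rw [interior_Ici, mem_Ioi] at hx
  rw [← derivWithin_of_mem_nhds (Ici_mem_nhds hx)]
  exact hM.u_deriv2_neg x hx.le

theorem Assumptions.exists_slope (hM : M.Assumptions) {w w' : ℝ} (hw : M.wmin ≤ w)
    (hlt : w < w') : ∃ z ∈ Ioo w w',
      M.u w' - M.u w = derivWithin M.u (Ici M.wmin) z * (w' - w) := by
  obtain ⟨z, hz, h⟩ := exists_deriv_eq_slope M.u hlt
    (hM.continuousOn_u.mono fun x hx => hw.trans hx.1)
    (fun x hx => ((hM.u_contDiffOn.differentiableOn (by norm_num) x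
      (hw.trans hx.1.le)).differentiableAt
        (Ici_mem_nhds (hw.trans_lt hx.1))).differentiableWithinAt)
  refine ⟨z, hz, ?_⟩
  rw [derivWithin_of_mem_nhds (Ici_mem_nhds (hw.trans_lt hz.1)), h,
    div_mul_cancel₀ _ (sub_pos.2 hlt).ne']

theorem Assumptions.strictMonoOn_u (hM : M.Assumptions) : StrictMonoOn M.u (Ici M.wmin) := by
  intro w hw w' _ hlt
  obtain ⟨z, hz, h⟩ := hM.exists_slope hw hlt
  have := mul_pos (hM.u_deriv_pos z ((mem_Ici.1 hw).trans hz.1.le)) (sub_pos.2 hlt)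
  linarith

theorem Assumptions.u_lt_tangent (hM : M.Assumptions) {w w' : ℝ} (hw : M.wmin ≤ w)
    (hw' : M.wmin ≤ w') (hne : w' ≠ w) :
    M.u w' < M.u w + derivWithin M.u (Ici M.wmin) w * (w' - w) := by
  rcases hne.lt_or_gt with hlt | hlt
  · obtain ⟨z, hz, h⟩ := hM.exists_slope hw' hlt
    have h1 := hM.strictAntiOn_derivWithin (hw'.trans hz.1.le) hw hz.2
    nlinarith
  · obtain ⟨z, hz, h⟩ := hM.exists_slope hw hlt
    have h1 := hM.strictAntiOn_derivWithin hw (hw.trans hz.1.le) hz.1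
    nlinarith

theorem wmin_le_h {t : ℝ} (ht : t ∈ M.utilities) : M.wmin ≤ M.h t :=
  Function.invFunOn_mem ht

theorem u_h {t : ℝ} (ht : t ∈ M.utilities) : M.u (M.h t) = t :=
  Function.invFunOn_eq ht

theorem u_mem_utilities {w : ℝ} (hw : M.wmin ≤ w) : M.u w ∈ M.utilities :=
  mem_image_of_mem _ hw

theorem u_wmin_mem : M.u M.wmin ∈ M.utilities := u_mem_utilities le_rfl

theorem Assumptions.h_u (hM : M.Assumptions) {w : ℝ} (hw : M.wmin ≤ w) : M.h (M.u w) = w :=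
  hM.strictMonoOn_u.injOn (wmin_le_h (u_mem_utilities hw)) hw (u_h (u_mem_utilities hw))

theorem Assumptions.u_wmin_le (hM : M.Assumptions) {t : ℝ} (ht : t ∈ M.utilities) :
    M.u M.wmin ≤ t := by
  obtain ⟨w, hw, rfl⟩ := ht
  exact hM.strictMonoOn_u.monotoneOn ((mem_Ici.2 le_rfl)) hw hw

theorem Assumptions.marginalCost_pos (hM : M.Assumptions) {t : ℝ} (ht : t ∈ M.utilities) :
    0 < M.marginalCost t :=
  inv_pos.2 (hM.u_deriv_pos _ (wmin_le_h ht))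

theorem Assumptions.ordConnected_utilities (hM : M.Assumptions) : OrdConnected M.utilities :=
  (isPreconnected_Ici.image _ hM.continuousOn_u).ordConnected

theorem Assumptions.convex_utilities (hM : M.Assumptions) : Convex ℝ M.utilities :=
  hM.ordConnected_utilities.convex

/-- Strict concavity of `u` read through its inverse. Monotonicity and convexity of `h` and strict
monotonicity of `marginalCost` are all drawn from this tangent inequality. -/
theorem Assumptions.tangent_lt_h (hM : M.Assumptions) {s t : ℝ} (hs : s ∈ M.utilities)
    (ht : t ∈ M.utilities) (hne : t ≠ s) :
    M.h s + M.marginalCost s * (t - s) < M.h t := by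
  have hne' : M.h t ≠ M.h s := fun h => hne (by rw [← u_h ht, h, u_h hs])
  have h1 := hM.u_lt_tangent (wmin_le_h hs) (wmin_le_h ht) hne'
  rw [u_h hs, u_h ht] at h1
  have hp := hM.u_deriv_pos _ (wmin_le_h hs)
  have h2 : M.marginalCost s * (t - s) < M.h t - M.h s := by
    rw [marginalCost, inv_mul_lt_iff₀ hp]
    linarith
  linarith

theorem Assumptions.tangent_le_h (hM : M.Assumptions) {s t : ℝ} (hs : s ∈ M.utilities)
    (ht : t ∈ M.utilities) : M.h s + M.marginalCost s * (t - s) ≤ M.h t := by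
  rcases eq_or_ne t s with rfl | hne
  · simp
  · exact (hM.tangent_lt_h hs ht hne).le

theorem Assumptions.marginalCost_strictMonoOn (hM : M.Assumptions) :
    StrictMonoOn M.marginalCost M.utilities := by
  intro s hs t ht hlt
  have h1 := hM.tangent_lt_h hs ht hlt.ne'
  have h2 := hM.tangent_lt_h ht hs hlt.ne
  nlinarith

theorem Assumptions.h_strictMonoOn (hM : M.Assumptions) : StrictMonoOn M.h M.utilities := by
  intro s hs t ht hlt
  have h1 := hM.tangent_lt_h hs ht hlt.ne'
  have := mul_pos (hM.marginalCost_pos hs) (sub_pos.2 hlt)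
  linarith

theorem Assumptions.h_convexOn (hM : M.Assumptions) : ConvexOn ℝ M.utilities M.h := by
  refine ⟨hM.convex_utilities, fun x hx y hy a b ha hb hab => ?_⟩
  have hz := hM.convex_utilities hx hy ha hb hab
  have h1 := hM.tangent_le_h hz hx
  have h2 := hM.tangent_le_h hz hy
  simp only [smul_eq_mul] at *
  set z := a * x + b * y
  have e : a * (M.h z + M.marginalCost z * (x - z)) + b * (M.h z + M.marginalCost z * (y - z))
      = M.h z := by
    have hb' : b = 1 - a := by linarith
    simp only [z, hb']
    ring
  nlinarith [mul_le_mul_of_nonneg_left h1 ha, mul_le_mul_of_nonneg_left h2 hb]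

/-- Since `u' → 0`, the marginal cost is unbounded, and the intermediate value theorem solves the
first-order condition. -/
theorem Assumptions.exists_marginalCost_eq (hM : M.Assumptions) {y : ℝ}
    (hy : M.marginalCost (M.u M.wmin) ≤ y) : ∃ t ∈ M.utilities, M.marginalCost t = y := by
  have hy0 : 0 < y := (hM.marginalCost_pos u_wmin_mem).trans_le hy
  obtain ⟨w1, hw1, hw1'⟩ := ((hM.u_deriv_tendsto.eventually_lt_const (inv_pos.2 hy0)).and
    (eventually_ge_atTop M.wmin)).exists
  have hmem : y⁻¹ ∈ Icc (derivWithin M.u (Ici M.wmin) w1) (derivWithin M.u (Ici M.wmin) M.wmin) := by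
    refine ⟨hw1.le, ?_⟩
    rw [marginalCost, hM.h_u le_rfl] at hy
    exact inv_le_of_inv_le₀ (hM.u_deriv_pos _ (mem_Ici.2 le_rfl)) hy
  obtain ⟨w, hw, hwy⟩ := intermediate_value_Icc' hw1'
    (hM.continuousOn_derivWithin.mono Icc_subset_Ici_self) hmem
  refine ⟨M.u w, u_mem_utilities hw.1, ?_⟩
  rw [marginalCost, hM.h_u hw.1, hwy, inv_inv]

/-- The minimizer solves the first-order condition when `y` is at least the marginal cost at the
lower end, and is the corner `u(wmin)` otherwise. -/
theorem Assumptions.bestUtility_spec (hM : M.Assumptions) (y : ℝ) :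
    M.bestUtility y ∈ M.utilities ∧ ∀ s ∈ M.utilities, s ≠ M.bestUtility y →
      M.h (M.bestUtility y) - y * M.bestUtility y < M.h s - y * s := by
  refine Classical.epsilon_spec (p := fun t => t ∈ M.utilities ∧
    ∀ s ∈ M.utilities, s ≠ t → M.h t - y * t < M.h s - y * s) ?_
  rcases le_total (M.marginalCost (M.u M.wmin)) y with hy | hy
  · obtain ⟨t, ht, rfl⟩ := hM.exists_marginalCost_eq hy
    exact ⟨t, ht, fun s hs hne => by linarith [hM.tangent_lt_h ht hs hne]⟩
  · refine ⟨M.u M.wmin, u_wmin_mem, fun s hs hne => ?_⟩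
    have h1 := hM.tangent_lt_h u_wmin_mem hs hne
    have h2 := hM.u_wmin_le hs
    nlinarith

theorem Assumptions.bestUtility_mem (hM : M.Assumptions) (y : ℝ) :
    M.bestUtility y ∈ M.utilities := (hM.bestUtility_spec y).1

theorem Assumptions.bestUtility_le (hM : M.Assumptions) (y : ℝ) {s : ℝ} (hs : s ∈ M.utilities) :
    M.h (M.bestUtility y) - y * M.bestUtility y ≤ M.h s - y * s := by
  rcases eq_or_ne s (M.bestUtility y) with h | h
  · rw [h]
  · exact ((hM.bestUtility_spec y).2 s hs h).le

theorem Assumptions.bestUtility_mono (hM : M.Assumptions) : Monotone M.bestUtility := by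
  intro y y' hyy
  by_contra! hlt
  have h1 := (hM.bestUtility_spec y).2 _ (hM.bestUtility_mem y') hlt.ne
  have h2 := (hM.bestUtility_spec y').2 _ (hM.bestUtility_mem y) hlt.ne'
  nlinarith

theorem Assumptions.bestUtility_marginalCost (hM : M.Assumptions) {t : ℝ}
    (ht : t ∈ M.utilities) : M.bestUtility (M.marginalCost t) = t := by
  by_contra hne
  have h1 := (hM.bestUtility_spec (M.marginalCost t)).2 t ht (Ne.symm hne)
  have h2 := hM.tangent_le_h ht (hM.bestUtility_mem (M.marginalCost t))
  linarith

theorem Assumptions.bestUtility_of_nonpos (hM : M.Assumptions) {y : ℝ} (hy : y ≤ 0) :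
    M.bestUtility y = M.u M.wmin := by
  by_contra hne
  have h1 := (hM.bestUtility_spec y).2 _ u_wmin_mem (Ne.symm hne)
  have hm := hM.bestUtility_mem y
  have h2 := hM.u_wmin_le hm
  have h3 := hM.h_strictMonoOn.monotoneOn u_wmin_mem hm h2
  nlinarith

/-- Nothing is known about `h` off `utilities`, so sublevel sets are pulled back through the
strictly increasing `u`. -/
theorem Assumptions.measurable_h_comp (hM : M.Assumptions) {Y : Type*} [MeasurableSpace Y]
    {v : Y → ℝ} (hv : Measurable v) (hr : ∀ y, v y ∈ M.utilities) :
    Measurable fun y => M.h (v y) := by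
  refine measurable_of_Iic fun w => ?_
  rcases le_or_gt M.wmin w with hw | hw
  · have : (fun y => M.h (v y)) ⁻¹' Iic w = v ⁻¹' Iic (M.u w) := by
      ext y
      simp only [mem_preimage, mem_Iic]
      rw [← hM.strictMonoOn_u.le_iff_le (wmin_le_h (hr y)) hw, u_h (hr y)]
    rw [this]
    exact hv measurableSet_Iic
  · have : (fun y => M.h (v y)) ⁻¹' Iic w = ∅ := by
      ext y
      simp only [mem_preimage, mem_Iic, mem_empty_iff_false, iff_false, not_le]
      exact hw.trans_le (wmin_le_h (hr y))
    rw [this]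
    exact MeasurableSet.empty

theorem Assumptions.cost_mem (hM : M.Assumptions) (a : A) : M.c a ∈ M.utilities :=
  interior_subset (hM.cost_mem_interior a)

theorem Assumptions.exists_mem_utilities_of_abs_le (hM : M.Assumptions) (a : A) :
    ∃ ε₀ : ℝ, 0 < ε₀ ∧ ∀ t : ℝ, |t - M.c a| ≤ ε₀ → t ∈ M.utilities := by
  obtain ⟨ε, hε, h⟩ := Metric.nhds_basis_closedBall.mem_iff.1
    (mem_interior_iff_mem_nhds.1 (hM.cost_mem_interior a))
  exact ⟨ε, hε, fun t ht => h (by rwa [Metric.mem_closedBall, Real.dist_eq])⟩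

/-- The Bregman divergence of `h` at `t` is bounded away from zero below `t₁ < t`. -/
theorem Assumptions.exists_bregman_lower_bound (hM : M.Assumptions) {t t₁ : ℝ}
    (ht : t ∈ M.utilities) (ht₁ : t₁ ∈ M.utilities) (hlt : t₁ < t) :
    ∃ β : ℝ, 0 < β ∧ ∀ s ∈ M.utilities, s ≤ t₁ →
      M.h t + M.marginalCost t * (s - t) + β ≤ M.h s := by
  refine ⟨M.h t₁ - (M.h t + M.marginalCost t * (t₁ - t)), ?_, fun s hs hst => ?_⟩
  · linarith [hM.tangent_lt_h ht ht₁ hlt.ne]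
  · have h1 := hM.tangent_le_h ht₁ hs
    have h2 := hM.marginalCost_strictMonoOn ht₁ ht hlt
    nlinarith

end Utility

end MoralHazard

/-! ### Product laws: densities, change of measure, law of large numbers. -/

section IID

variable {X : Type*} [MeasurableSpace X]

theorem integrable_exp_of_withDensity {μ ν : Measure X} [IsProbabilityMeasure ν] {F : X → ℝ}
    (hF : Measurable F) (hν : ν = μ.withDensity fun x => ENNReal.ofReal (Real.exp (F x))) :
    Integrable (fun x => Real.exp (F x)) μ := by
  refine ⟨(Real.measurable_exp.comp hF).aestronglyMeasurable, ?_⟩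
  have h1 : ν univ = ∫⁻ x, ENNReal.ofReal (Real.exp (F x)) ∂μ := by
    rw [hν, withDensity_apply _ MeasurableSet.univ, Measure.restrict_univ]
  rw [hasFiniteIntegral_iff_ofReal (ae_of_all _ fun x => (Real.exp_pos _).le), ← h1, measure_univ]
  exact ENNReal.one_lt_top

/-- The density of the law of i.i.d. draws with respect to another such law. -/
theorem pi_eq_withDensity {μ ν : Measure X} [IsProbabilityMeasure μ] [IsProbabilityMeasure ν]
    {F : X → ℝ} (hF : Measurable F)
    (hν : ν = μ.withDensity fun x => ENNReal.ofReal (Real.exp (F x))) (n : ℕ) :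
    Measure.pi (fun _ : Fin n => ν) = (Measure.pi fun _ : Fin n => μ).withDensity
      fun x => ENNReal.ofReal (Real.exp (∑ i, F (x i))) := by
  have hint := integrable_exp_of_withDensity hF hν
  refine (Measure.pi_eq fun s hs => ?_)
  have hbox : MeasurableSet (univ.pi s) := MeasurableSet.univ_pi hs
  -- On boxes the density factorizes over coordinates, so Fubini reduces the claim to one draw.
  have h1 : ∀ x : Fin n → X, (univ.pi s).indicator
      (fun x => ENNReal.ofReal (Real.exp (∑ i, F (x i)))) x =
      ENNReal.ofReal (∏ i, (s i).indicator (fun y => Real.exp (F y)) (x i)) := by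
    intro x
    by_cases hx : x ∈ univ.pi s
    · rw [indicator_of_mem hx, Real.exp_sum]
      congr 1
      refine Finset.prod_congr rfl fun i _ => ?_
      rw [indicator_of_mem (hx i (mem_univ i))]
    · rw [indicator_of_notMem hx]
      obtain ⟨i, hi⟩ : ∃ i, x i ∉ s i := by simpa [mem_univ_pi] using hx
      rw [Finset.prod_eq_zero (Finset.mem_univ i) (indicator_of_notMem hi _), ENNReal.ofReal_zero]
  have hint' : ∀ i, Integrable ((s i).indicator fun y => Real.exp (F y)) μ :=
    fun i => hint.indicator (hs i)
  have hnn : ∀ i y, 0 ≤ (s i).indicator (fun y => Real.exp (F y)) y :=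
    fun i => indicator_nonneg fun _ _ => (Real.exp_pos _).le
  rw [withDensity_apply _ hbox, ← lintegral_indicator hbox, lintegral_congr h1,
    ← ofReal_integral_eq_lintegral_ofReal (Integrable.fintype_prod_dep hint')
      (ae_of_all _ fun x => Finset.prod_nonneg fun i _ => hnn i _),
    integral_fintype_prod_eq_prod, ENNReal.ofReal_prod_of_nonneg
      fun i _ => integral_nonneg (hnn i)]
  refine Finset.prod_congr rfl fun i _ => ?_
  rw [ofReal_integral_eq_lintegral_ofReal (hint' i) (ae_of_all _ (hnn i)), hν,
    withDensity_apply _ (hs i), ← lintegral_indicator (hs i)]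
  refine lintegral_congr fun y => ?_
  by_cases hy : y ∈ s i <;> simp [hy]

/-- On `E` the density is at most `exp s`. This serves both the Chernoff upper bound on scores and
the large deviation lower bound. -/
theorem pi_le_exp_mul_pi {μ ν : Measure X} [IsProbabilityMeasure μ] [IsProbabilityMeasure ν]
    {F : X → ℝ} (hF : Measurable F)
    (hν : ν = μ.withDensity fun x => ENNReal.ofReal (Real.exp (F x))) {n : ℕ}
    {E : Set (Fin n → X)} (hE : MeasurableSet E) {s : ℝ} (hs : ∀ x ∈ E, ∑ i, F (x i) ≤ s) :
    (Measure.pi fun _ : Fin n => ν).real E ≤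
      Real.exp s * (Measure.pi fun _ : Fin n => μ).real E := by
  have h : (Measure.pi fun _ : Fin n => ν) E ≤
      ENNReal.ofReal (Real.exp s) * (Measure.pi fun _ : Fin n => μ) E := by
    rw [pi_eq_withDensity hF hν, withDensity_apply _ hE, ← setLIntegral_const]
    refine setLIntegral_mono' hE fun x hx => ENNReal.ofReal_le_ofReal ?_
    exact Real.exp_le_exp.2 (hs x hx)
  have := ENNReal.toReal_mono (by finiteness) h
  rwa [ENNReal.toReal_mul, ENNReal.toReal_ofReal (Real.exp_pos _).le] at this

/-- The weak law of large numbers. -/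
theorem tendsto_pi_abs_sub_ge {ν : Measure X} [IsProbabilityMeasure ν] {F : X → ℝ}
    (hF : MemLp F 2 ν) {ε : ℝ} (hε : 0 < ε) :
    Tendsto (fun n : ℕ => (Measure.pi fun _ : Fin n => ν).real
      {x | ε ≤ |(1 / (n : ℝ)) * ∑ i, F (x i) - ∫ y, F y ∂ν|}) atTop (𝓝 0) := by
  have hlim : Tendsto (fun n : ℕ => (ProbabilityTheory.variance F ν / ε ^ 2) * (n : ℝ)⁻¹)
      atTop (𝓝 0) := by
    simpa using (tendsto_inv_atTop_nhds_zero_nat (𝕜 := ℝ)).const_mul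
      (ProbabilityTheory.variance F ν / ε ^ 2)
  refine squeeze_zero' (Eventually.of_forall fun n => measureReal_nonneg) ?_ hlim
  filter_upwards [eventually_gt_atTop 0] with n hn
  have hn' : (0 : ℝ) < n := by exact_mod_cast hn
  have hmp : ∀ i : Fin n, MemLp (fun x : Fin n → X => F (x i)) 2 (Measure.pi fun _ => ν) :=
    fun i => hF.comp_measurePreserving (measurePreserving_eval (fun _ : Fin n => ν) i)
  have hS : MemLp (fun x : Fin n → X => (1 / (n : ℝ)) * ∑ i, F (x i)) 2
      (Measure.pi fun _ => ν) := (memLp_finsetSum _ fun i _ => hmp i).const_mul _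
  have hmean : ∫ x : Fin n → X, (1 / (n : ℝ)) * ∑ i, F (x i) ∂(Measure.pi fun _ => ν) =
      ∫ y, F y ∂ν := by
    rw [integral_const_mul, integral_finsetSum _ fun i _ => (hmp i).integrable (by norm_num)]
    have : ∀ i : Fin n, ∫ x : Fin n → X, F (x i) ∂(Measure.pi fun _ => ν) = ∫ y, F y ∂ν :=
      fun i => integral_comp_eval hF.aestronglyMeasurable
    simp only [this, Finset.sum_const, Finset.card_univ, Fintype.card_fin, nsmul_eq_mul]
    field_simp
  have hvar : ProbabilityTheory.variance (fun x : Fin n → X => (1 / (n : ℝ)) * ∑ i, F (x i))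
      (Measure.pi fun _ => ν) = ProbabilityTheory.variance F ν / n := by
    rw [ProbabilityTheory.variance_const_mul]
    have := ProbabilityTheory.variance_sum_pi (μ := fun _ : Fin n => ν) (X := fun _ => F)
      (fun _ => hF)
    have e : (fun x : Fin n → X => ∑ i, F (x i)) = ∑ i, fun x : Fin n → X => F (x i) := by
      ext x; simp
    rw [e, this]
    simp only [Finset.sum_const, Finset.card_univ, Fintype.card_fin, nsmul_eq_mul]
    field_simp
  have h := ProbabilityTheory.meas_ge_le_variance_div_sq hS hε
  rw [hmean, hvar] at h
  have := ENNReal.toReal_mono (by finiteness) h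
  rw [ENNReal.toReal_ofReal (by have := ProbabilityTheory.variance_nonneg F ν; positivity)] at this
  refine this.trans (le_of_eq ?_)
  field_simp

end IID

namespace MoralHazard

/-! ### Moments, change of measure and concentration of log-likelihood scores. -/

section Likelihood

variable {A X : Type*} [MeasurableSpace X] {M : MoralHazard A X}

/-- The expected log-likelihood ratio vector under action `b`. -/
noncomputable def meanScore (M : MoralHazard A X) (b : A) : M.Score :=
  fun a => ∫ x, M.logRatio x a ∂(M.μ b)

theorem Assumptions.isProbabilityMeasure_law (hM : M.Assumptions) (n : ℕ) (a : A) :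
    IsProbabilityMeasure (M.law n a) := by
  have := hM.isProbabilityMeasure
  unfold law
  infer_instance

theorem measurable_logRatio_apply (M : MoralHazard A X) (a : M.Deviation) :
    Measurable fun x => M.logRatio x a := measurable_llr _ _

theorem measurable_logRatio (M : MoralHazard A X) : Measurable M.logRatio :=
  measurable_pi_iff.2 M.measurable_logRatio_apply

theorem measurable_score (M : MoralHazard A X) (n : ℕ) : Measurable (M.score n) := by
  refine measurable_pi_iff.2 fun a => ?_
  exact (Finset.measurable_sum _ fun i _ =>
    (M.measurable_logRatio_apply a).comp (measurable_pi_apply i)).const_mul _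

theorem measurable_score_apply (M : MoralHazard A X) (n : ℕ) (a : M.Deviation) :
    Measurable fun x => M.score n x a :=
  (measurable_pi_apply a).comp (M.measurable_score n)

theorem nat_mul_score {n : ℕ} (hn : 0 < n) (x : Fin n → X) (a : M.Deviation) :
    n * M.score n x a = ∑ i, M.logRatio (x i) a := by
  have : (n : ℝ) ≠ 0 := by exact_mod_cast hn.ne'
  rw [score]
  field_simp

theorem Assumptions.target_eq_withDensity (hM : M.Assumptions) (a : M.Deviation) :
    M.μ M.target = (M.μ a).withDensity fun x => ENNReal.ofReal (Real.exp (M.logRatio x a)) := by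
  have := hM.isProbabilityMeasure
  nth_rw 1 [← Measure.withDensity_rnDeriv_eq _ _ (hM.absolutelyContinuous a M.target)]
  refine withDensity_congr_ae ?_
  have h1 := exp_llr_of_ac' (M.μ M.target) (M.μ a) (hM.absolutelyContinuous M.target a)
  filter_upwards [h1, Measure.rnDeriv_lt_top (M.μ M.target) (M.μ a)] with x hx hx'
  rw [logRatio, hx, ENNReal.ofReal_toReal hx'.ne]

theorem Assumptions.eq_withDensity_target (hM : M.Assumptions) (a : M.Deviation) :
    M.μ a = (M.μ M.target).withDensity
      fun x => ENNReal.ofReal (Real.exp (-M.logRatio x a)) := by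
  have := hM.isProbabilityMeasure
  nth_rw 1 [← Measure.withDensity_rnDeriv_eq _ _ (hM.absolutelyContinuous M.target a)]
  refine withDensity_congr_ae ?_
  have h1 := exp_neg_llr (hM.absolutelyContinuous a M.target)
  filter_upwards [h1, Measure.rnDeriv_lt_top (M.μ a) (M.μ M.target)] with x hx hx'
  rw [logRatio, hx, ENNReal.ofReal_toReal hx'.ne]

/-- Passing from `μ b` to `μ a` introduces a second density; the product is at most the sum of the
squares, which `mgf_finite` controls. -/
theorem Assumptions.lintegral_rnDeriv_lt_top (hM : M.Assumptions) (a a' b : A) :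
    ∫⁻ x, (M.μ a').rnDeriv (M.μ a) x ∂(M.μ b) < ⊤ := by
  have := hM.isProbabilityMeasure
  have hb : M.μ b = (M.μ a).withDensity ((M.μ b).rnDeriv (M.μ a)) :=
    (Measure.withDensity_rnDeriv_eq _ _ (hM.absolutelyContinuous a b)).symm
  rw [hb, lintegral_withDensity_eq_lintegral_mul _ (Measure.measurable_rnDeriv _ _)
    (Measure.measurable_rnDeriv _ _)]
  refine lt_of_le_of_lt (lintegral_mono (g := fun x => (M.μ b).rnDeriv (M.μ a) x ^ (2 : ℝ) +
    (M.μ a').rnDeriv (M.μ a) x ^ (2 : ℝ)) fun x => ?_) ?_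
  · simp only [Pi.mul_apply, ENNReal.rpow_two, sq]
    rcases le_total ((M.μ b).rnDeriv (M.μ a) x) ((M.μ a').rnDeriv (M.μ a) x) with h | h
    · exact le_add_left (mul_le_mul_left h _)
    · exact le_add_right (mul_le_mul_right h _)
  · rw [lintegral_add_left ((Measure.measurable_rnDeriv _ _).pow_const _)]
    exact ENNReal.add_lt_top.2 ⟨hM.mgf_finite a b 2 (by norm_num),
      hM.mgf_finite a a' 2 (by norm_num)⟩

theorem sq_log_le {r : ℝ} (hr : 0 < r) : Real.log r ^ 2 ≤ 4 * (r + r⁻¹) := by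
  have key : ∀ y : ℝ, 1 ≤ y → Real.log y ^ 2 ≤ 4 * y := by
    intro y hy
    have h0 : 0 ≤ Real.log y := Real.log_nonneg hy
    have h1 : Real.log y = 2 * Real.log (Real.sqrt y) := by
      rw [Real.log_sqrt (by linarith)]; ring
    have h2 : Real.log (Real.sqrt y) ≤ Real.sqrt y :=
      Real.log_le_self (Real.sqrt_nonneg _)
    have h3 := Real.sq_sqrt (show (0 : ℝ) ≤ y by linarith)
    nlinarith [Real.sqrt_nonneg y]
  have hi := inv_pos.2 hr
  rcases le_total 1 r with h | h
  · linarith [key r h]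
  · have := key r⁻¹ ((one_le_inv₀ hr).2 h)
    rw [Real.log_inv, neg_sq] at this
    linarith

/-- By `sq_log_le`, the squared log-ratio is dominated by the likelihood ratio plus its inverse,
both integrable under every action. -/
theorem Assumptions.memLp_logRatio (hM : M.Assumptions) (a : M.Deviation) (b : A) :
    MemLp (fun x => M.logRatio x a) 2 (M.μ b) := by
  have := hM.isProbabilityMeasure
  rw [memLp_two_iff_integrable_sq (M.measurable_logRatio_apply a).aestronglyMeasurable]
  have hi : ∀ c c' : A, Integrable (fun x => ((M.μ c').rnDeriv (M.μ c) x).toReal) (M.μ b) :=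
    fun c c' => integrable_toReal_of_lintegral_ne_top
      (Measure.measurable_rnDeriv _ _).aemeasurable (hM.lintegral_rnDeriv_lt_top c c' b).ne
  refine Integrable.mono' (((hi a M.target).add (hi M.target a)).const_mul 4)
    ((M.measurable_logRatio_apply a).pow_const 2).aestronglyMeasurable ?_
  have h1 := (hM.absolutelyContinuous M.target b).ae_le
    (exp_llr_of_ac _ _ (hM.absolutelyContinuous a M.target))
  have h3 := (hM.absolutelyContinuous M.target b).ae_le
    (exp_neg_llr (hM.absolutelyContinuous a M.target))
  filter_upwards [h1, h3] with x hx hx'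
  rw [Real.norm_of_nonneg (sq_nonneg _)]
  simp only [Pi.add_apply]
  rw [← hx, ← hx', Real.exp_neg]
  have := sq_log_le (Real.exp_pos (llr (M.μ M.target) (M.μ a) x))
  rwa [Real.log_exp] at this

theorem Assumptions.integrable_logRatio (hM : M.Assumptions) (a : M.Deviation) (b : A) :
    Integrable (fun x => M.logRatio x a) (M.μ b) := by
  have := hM.isProbabilityMeasure
  exact (hM.memLp_logRatio a b).integrable (by norm_num)

theorem Assumptions.integral_score (hM : M.Assumptions) (a : M.Deviation) (b : A) {n : ℕ}
    (hn : 0 < n) : ∫ x, M.score n x a ∂(M.law n b) = M.meanScore b a := by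
  have := hM.isProbabilityMeasure
  have hn' : (n : ℝ) ≠ 0 := by exact_mod_cast hn.ne'
  simp only [score, law]
  rw [integral_const_mul, integral_finsetSum]
  · have : ∀ i : Fin n, ∫ x : Fin n → X, M.logRatio (x i) a ∂(Measure.pi fun _ => M.μ b) =
        ∫ y, M.logRatio y a ∂(M.μ b) :=
      fun i => integral_comp_eval (M.measurable_logRatio_apply a).aestronglyMeasurable
    simp only [this, Finset.sum_const, Finset.card_univ, Fintype.card_fin, nsmul_eq_mul, meanScore]
    field_simp
  · intro i _
    exact ((hM.memLp_logRatio a b).comp_measurePreserving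
      (measurePreserving_eval (fun _ : Fin n => M.μ b) i)).integrable (by norm_num)

theorem Assumptions.law_absolutelyContinuous (hM : M.Assumptions) (n : ℕ) (a b : A) :
    M.law n b ≪ M.law n a := by
  have := hM.isProbabilityMeasure
  have h1 : M.law n b ≪ M.law n M.target := by
    by_cases hb : b = M.target
    · rw [hb]
    · rw [law, pi_eq_withDensity (M.measurable_logRatio_apply ⟨b, hb⟩).neg
        (hM.eq_withDensity_target ⟨b, hb⟩) n]
      exact withDensity_absolutelyContinuous _ _
  have h2 : M.law n M.target ≪ M.law n a := by
    by_cases ha : a = M.target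
    · rw [ha]
    · rw [law, pi_eq_withDensity (M.measurable_logRatio_apply ⟨a, ha⟩)
        (hM.target_eq_withDensity ⟨a, ha⟩) n]
      exact withDensity_absolutelyContinuous _ _
  exact h1.trans h2

theorem Assumptions.law_eq_withDensity (hM : M.Assumptions) {n : ℕ} (hn : 0 < n)
    (a : M.Deviation) : M.law n a = (M.law n M.target).withDensity
      fun x => ENNReal.ofReal (Real.exp (-(n * M.score n x a))) := by
  have := hM.isProbabilityMeasure
  have h := pi_eq_withDensity (M.measurable_logRatio_apply a).neg (hM.eq_withDensity_target a) n
  simp only [Pi.neg_apply, Finset.sum_neg_distrib] at h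
  simp only [nat_mul_score hn]
  exact h

theorem measurable_exp_neg_score (M : MoralHazard A X) (n : ℕ) (a : M.Deviation) :
    Measurable fun x => Real.exp (-(n * M.score n x a)) :=
  Real.measurable_exp.comp ((M.measurable_score_apply n a).const_mul _).neg

/-- Expressing deviation payoffs under the target law is what lets the Lagrangian be minimized
signal by signal. -/
theorem Assumptions.integral_law (hM : M.Assumptions) {n : ℕ} (hn : 0 < n)
    (a : M.Deviation) (f : (Fin n → X) → ℝ) :
    ∫ x, f x ∂(M.law n a) =
      ∫ x, Real.exp (-(n * M.score n x a)) * f x ∂(M.law n M.target) := by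
  rw [hM.law_eq_withDensity hn a, integral_withDensity_eq_integral_toReal_smul
    (M.measurable_exp_neg_score n a).ennreal_ofReal (ae_of_all _ fun _ => ENNReal.ofReal_lt_top)]
  refine integral_congr_ae (ae_of_all _ fun x => ?_)
  simp [ENNReal.toReal_ofReal (Real.exp_pos _).le]

theorem Assumptions.integrable_law_iff (hM : M.Assumptions) {n : ℕ} (hn : 0 < n)
    (a : M.Deviation) (f : (Fin n → X) → ℝ) : Integrable f (M.law n a) ↔
      Integrable (fun x => Real.exp (-(n * M.score n x a)) * f x) (M.law n M.target) := by
  rw [hM.law_eq_withDensity hn a, integrable_withDensity_iff_integrable_smul'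
    (M.measurable_exp_neg_score n a).ennreal_ofReal (ae_of_all _ fun _ => ENNReal.ofReal_lt_top)]
  refine integrable_congr (ae_of_all _ fun x => ?_)
  simp [ENNReal.toReal_ofReal (Real.exp_pos _).le]

/-- Chernoff bound: the density of the target law relative to `a` is `exp (n * score)`, at most `exp
(n * t)` on this event. -/
theorem Assumptions.law_score_le (hM : M.Assumptions) {n : ℕ} (hn : 0 < n) (a : M.Deviation)
    (t : ℝ) : (M.law n M.target).real {x | M.score n x a ≤ t} ≤ Real.exp (n * t) := by
  have := hM.isProbabilityMeasure
  have := hM.isProbabilityMeasure_law n a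
  have h := pi_le_exp_mul_pi (n := n) (M.measurable_logRatio_apply a) (hM.target_eq_withDensity a)
    (E := {x | M.score n x a ≤ t}) (measurableSet_le (M.measurable_score_apply n a) measurable_const)
    (s := n * t) (fun x hx => by
      rw [← nat_mul_score hn]
      exact mul_le_mul_of_nonneg_left hx (Nat.cast_nonneg n))
  refine h.trans (mul_le_of_le_one_right (Real.exp_pos _).le ?_)
  exact measureReal_le_one

theorem Assumptions.tendsto_law_score (hM : M.Assumptions) (a : M.Deviation) (b : A) {ε : ℝ}
    (hε : 0 < ε) : Tendsto (fun n : ℕ => (M.law n b).real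
      {x | ε ≤ |M.score n x a - M.meanScore b a|}) atTop (𝓝 0) := by
  have := hM.isProbabilityMeasure
  exact tendsto_pi_abs_sub_ge (hM.memLp_logRatio a b) hε

theorem Assumptions.tendsto_law_exists_score [Finite A] (hM : M.Assumptions) (b : A) {ε : ℝ}
    (hε : 0 < ε) : Tendsto (fun n : ℕ => (M.law n b).real
      {x | ∃ a, ε ≤ |M.score n x a - M.meanScore b a|}) atTop (𝓝 0) := by
  have := Fintype.ofFinite M.Deviation
  have hlim := tendsto_finsetSum (Finset.univ : Finset M.Deviation)
    fun a _ => hM.tendsto_law_score a b hε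
  rw [Finset.sum_const_zero] at hlim
  refine squeeze_zero (fun n => measureReal_nonneg) (fun n => ?_) hlim
  have := hM.isProbabilityMeasure_law n b
  rw [ofPred_exists]
  exact measureReal_iUnion_fintype_le _

/-- Scores are log-ratios of the target against `a`, so the divergence of `a` from the target is
minus the mean score of `a`; identification makes it strictly positive. -/
theorem Assumptions.klDiv_deviation (hM : M.Assumptions) (a : M.Deviation) :
    M.meanScore a a < 0 ∧ InformationTheory.klDiv (M.μ a) (M.μ M.target) =
      ENNReal.ofReal (-M.meanScore a a) := by
  have := hM.isProbabilityMeasure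
  have hac := hM.absolutelyContinuous M.target a
  have hn := neg_llr hac
  have he : ∫ x, llr (M.μ a) (M.μ M.target) x ∂(M.μ a) = - M.meanScore a a := by
    rw [meanScore, ← integral_neg]
    refine integral_congr_ae ?_
    filter_upwards [hn] with x hx
    rw [logRatio, ← hx, Pi.neg_apply, neg_neg]
  have hi : Integrable (llr (M.μ a) (M.μ M.target)) (M.μ a) := by
    refine (hM.integrable_logRatio a a).neg.congr ?_
    filter_upwards [hn] with x hx
    simp only [Pi.neg_apply] at hx ⊢
    rw [logRatio, ← hx, neg_neg]
  have htop := InformationTheory.klDiv_ne_top hac hi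
  have h := InformationTheory.toReal_klDiv_of_measure_eq hac (by simp)
  rw [he] at h
  have hpos : InformationTheory.klDiv (M.μ a) (M.μ M.target) ≠ 0 := by
    rw [Ne, InformationTheory.klDiv_eq_zero_iff]
    exact hM.identified _ _ a.2
  refine ⟨?_, by rw [← h, ENNReal.ofReal_toReal htop]⟩
  have := ENNReal.toReal_pos hpos htop
  linarith

theorem Assumptions.meanScore_target_pos (hM : M.Assumptions) (a : M.Deviation) :
    0 < M.meanScore M.target a := by
  have := hM.isProbabilityMeasure
  have hac := hM.absolutelyContinuous a M.target
  have hi : Integrable (llr (M.μ M.target) (M.μ a)) (M.μ M.target) :=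
    hM.integrable_logRatio a M.target
  have h := InformationTheory.toReal_klDiv_of_measure_eq hac (by simp)
  have hpos : InformationTheory.klDiv (M.μ M.target) (M.μ a) ≠ 0 := by
    rw [Ne, InformationTheory.klDiv_eq_zero_iff]
    exact hM.identified _ _ a.2.symm
  have := ENNReal.toReal_pos hpos (InformationTheory.klDiv_ne_top hac hi)
  rw [h] at this
  exact this

end Likelihood

end MoralHazard

namespace MoralHazard

/-! ### Lagrange multipliers and the pointwise form of optimal contracts. -/

section Duality

variable {A X : Type*} [MeasurableSpace X] {M : MoralHazard A X} {n : ℕ}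

/-- A utility contract with finite expected utilities and finite expected cost. -/
structure IsContract (M : MoralHazard A X) {n : ℕ} (v : (Fin n → X) → ℝ) : Prop where
  measurable : Measurable v
  range : ∀ x, v x ∈ M.utilities
  integrable : ∀ a, Integrable v (M.law n a)
  integrable_cost : Integrable (fun x => M.h (v x)) (M.law n M.target)

open Classical in
/-- The slack in the incentive constraint against `a`; for the target action, the slack in the
individual rationality constraint. -/
noncomputable def slack (M : MoralHazard A X) {n : ℕ} (v : (Fin n → X) → ℝ) (a : A) : ℝ :=
  (∫ x, v x ∂(M.law n M.target) - M.c M.target) -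
    if a = M.target then 0 else ∫ x, v x ∂(M.law n a) - M.c a

theorem slack_target (v : (Fin n → X) → ℝ) :
    M.slack v M.target = ∫ x, v x ∂(M.law n M.target) - M.c M.target := by
  simp [slack]

theorem slack_deviation (v : (Fin n → X) → ℝ) (a : M.Deviation) :
    M.slack v a = (∫ x, v x ∂(M.law n M.target) - M.c M.target) -
      (∫ x, v x ∂(M.law n a) - M.c a) := by
  simp [slack, a.2]

theorem feasible_iff {v : (Fin n → X) → ℝ} :
    M.Feasible v ↔ M.IsContract v ∧ ∀ a, 0 ≤ M.slack v a := by
  constructor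
  · refine fun h => ⟨⟨h.measurable, h.range, h.integrable, h.integrable_cost⟩, fun a => ?_⟩
    by_cases ha : a = M.target
    · rw [ha, slack_target]
      exact h.ir
    · have := slack_deviation v (⟨a, ha⟩ : M.Deviation)
      rw [this]
      linarith [h.ic a]
  · rintro ⟨h, hs⟩
    refine ⟨h.measurable, h.range, h.integrable, h.integrable_cost, fun a => ?_, ?_⟩
    · by_cases ha : a = M.target
      · rw [ha]
      · have h1 := slack_deviation v (⟨a, ha⟩ : M.Deviation)
        have h2 := hs a
        simp only at h1
        linarith
    · have := hs M.target
      rwa [slack_target] at this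

theorem sum_mul_slack [Fintype A] [Fintype M.Deviation] (l : A → ℝ) (v : (Fin n → X) → ℝ) :
    ∑ a, l a * M.slack v a = (∑ a, l a) * (∫ x, v x ∂(M.law n M.target) - M.c M.target) -
      ∑ a : M.Deviation, l a * (∫ x, v x ∂(M.law n a) - M.c a) := by
  classical
  have h : ∑ a : M.Deviation, l a * (∫ x, v x ∂(M.law n a) - M.c a) =
      ∑ a, l a * (if a = M.target then 0 else ∫ x, v x ∂(M.law n a) - M.c a) := by
    rw [← Finset.sum_subtype (Finset.univ.filter fun a => a ≠ M.target) (by simp)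
      (fun a => l a * (∫ x, v x ∂(M.law n a) - M.c a)), Finset.sum_filter]
    refine Finset.sum_congr rfl fun a _ => ?_
    by_cases ha : a = M.target <;> simp [ha]
  rw [h, Finset.sum_mul, ← Finset.sum_sub_distrib]
  refine Finset.sum_congr rfl fun a _ => ?_
  rw [slack, mul_sub]

theorem Assumptions.isContract_of_le (hM : M.Assumptions) {v : (Fin n → X) → ℝ}
    (hv : Measurable v) (hr : ∀ x, v x ∈ M.utilities) {T : ℝ} (hT : T ∈ M.utilities)
    (hvT : ∀ x, v x ≤ T) : M.IsContract v := by
  have := hM.isProbabilityMeasure_law n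
  refine ⟨hv, hr, fun a => ?_, ?_⟩
  · exact Integrable.of_mem_Icc (M.u M.wmin) T hv.aemeasurable
      (ae_of_all _ fun x => ⟨hM.u_wmin_le (hr x), hvT x⟩)
  · exact Integrable.of_mem_Icc M.wmin (M.h T) (hM.measurable_h_comp hv hr).aemeasurable
      (ae_of_all _ fun x => ⟨wmin_le_h (hr x), hM.h_strictMonoOn.monotoneOn (hr x) hT (hvT x)⟩)

theorem IsContract.convexCombination (hM : M.Assumptions) {v v' : (Fin n → X) → ℝ}
    (hv : M.IsContract v) (hv' : M.IsContract v') {p q : ℝ} (hp : 0 ≤ p) (hq : 0 ≤ q)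
    (hpq : p + q = 1) : M.IsContract (fun x => p * v x + q * v' x) ∧
      M.cost (fun x => p * v x + q * v' x) ≤ p * M.cost v + q * M.cost v' := by
  have hmeas : Measurable fun x => p * v x + q * v' x :=
    (hv.measurable.const_mul p).add (hv'.measurable.const_mul q)
  have hr : ∀ x, p * v x + q * v' x ∈ M.utilities :=
    fun x => hM.convex_utilities (hv.range x) (hv'.range x) hp hq hpq
  have hle : ∀ x, M.h (p * v x + q * v' x) ≤ p * M.h (v x) + q * M.h (v' x) :=
    fun x => hM.h_convexOn.2 (hv.range x) (hv'.range x) hp hq hpq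
  have hi : Integrable (fun x => p * M.h (v x) + q * M.h (v' x)) (M.law n M.target) :=
    (hv.integrable_cost.const_mul p).add (hv'.integrable_cost.const_mul q)
  have := hM.isProbabilityMeasure_law n M.target
  have hc : Integrable (fun x => M.h (p * v x + q * v' x)) (M.law n M.target) := by
    refine integrable_of_le_of_le (hM.measurable_h_comp hmeas hr).aestronglyMeasurable
      (ae_of_all _ fun x => wmin_le_h (hr x)) (ae_of_all _ hle) (integrable_const M.wmin) hi
  refine ⟨⟨hmeas, hr, fun a => ((hv.integrable a).const_mul p).add
    ((hv'.integrable a).const_mul q), hc⟩, ?_⟩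
  rw [cost, cost, cost, ← integral_const_mul, ← integral_const_mul,
    ← integral_add (hv.integrable_cost.const_mul p) (hv'.integrable_cost.const_mul q)]
  exact integral_mono hc hi hle

theorem IsContract.slack_convexCombination {v v' : (Fin n → X) → ℝ}
    (hv : M.IsContract v) (hv' : M.IsContract v') {p q : ℝ} (hpq : p + q = 1) (a : A) :
    M.slack (fun x => p * v x + q * v' x) a = p * M.slack v a + q * M.slack v' a := by
  have h : ∀ b, ∫ x, p * v x + q * v' x ∂(M.law n b) =
      p * ∫ x, v x ∂(M.law n b) + q * ∫ x, v' x ∂(M.law n b) := fun b => by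
    rw [integral_add ((hv.integrable b).const_mul p) ((hv'.integrable b).const_mul q),
      integral_const_mul, integral_const_mul]
  have hq : q = 1 - p := by linarith
  simp only [slack, h]
  split_ifs <;> rw [hq] <;> ring

theorem nonpos_of_forall_add_mul_lt {x y α : ℝ} (h : ∀ r : ℝ, 0 < r → x + r * α < y) :
    α ≤ 0 := by
  by_contra! hα
  have h1 := h ((|y - x| + 1) / α) (by positivity)
  rw [div_mul_cancel₀ _ hα.ne'] at h1
  linarith [le_abs_self (y - x)]

/-- Nonnegative multipliers `l` for which the contract `w` attains the minimum of the Lagrangian. -/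
structure IsMultiplier [Fintype A] (M : MoralHazard A X) {n : ℕ} (w : (Fin n → X) → ℝ)
    (l : A → ℝ) : Prop where
  nonneg : ∀ a, 0 ≤ l a
  le_cost : ∀ v : (Fin n → X) → ℝ, M.IsContract v →
    M.cost w + ∑ a, l a * M.slack v a ≤ M.cost v

/-- Lagrange multipliers for the second-best problem exist under Slater's condition. -/
theorem Assumptions.exists_multipliers [Fintype A] (hM : M.Assumptions)
    {w : (Fin n → X) → ℝ} (hw : M.IsOptimal w) {z : (Fin n → X) → ℝ} (hz : M.IsContract z)
    (hzs : ∀ a, 0 < M.slack z a) : ∃ l : A → ℝ, M.IsMultiplier w l := by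
  classical
  -- Pairs (slack, cost) strictly worse than some contract. Strictness makes `C` open, so it can be
  -- separated from the optimal value point, which optimality keeps outside `C`.
  set C : Set ((A → ℝ) × ℝ) := {p | ∃ v : (Fin n → X) → ℝ, M.IsContract v ∧
    M.cost v < p.2 ∧ ∀ a, p.1 a < M.slack v a} with hC
  have hopen : IsOpen C := by
    have : C = ⋃ v : {v : (Fin n → X) → ℝ // M.IsContract v},
        ({p | M.cost v.1 < p.2} ∩ ⋂ a, {p | p.1 a < M.slack v.1 a}) := by
      ext p
      simp [hC, and_left_comm]
    rw [this]
    refine isOpen_iUnion fun v => (isOpen_lt continuous_const continuous_snd).inter ?_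
    exact isOpen_iInter_of_finite fun a =>
      isOpen_lt ((continuous_apply a).comp continuous_fst) continuous_const
  have hconv : Convex ℝ C := by
    rintro p ⟨v, hv, hvc, hvs⟩ q ⟨v', hv', hvc', hvs'⟩ s t hs ht hst
    obtain ⟨h1, h2⟩ := hv.convexCombination hM hv' hs ht hst
    have key : ∀ a b c d : ℝ, a < b → c < d → s * a + t * c < s * b + t * d := by
      intro a b c d hab hcd
      rcases hs.eq_or_lt with rfl | hs'
      · have : t = 1 := by linarith
        subst this
        linarith
      · nlinarith [mul_lt_mul_of_pos_left hab hs', mul_le_mul_of_nonneg_left hcd.le ht]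
    refine ⟨_, h1, h2.trans_lt ?_, fun a => ?_⟩
    · exact key _ _ _ _ hvc hvc'
    · rw [hv.slack_convexCombination hv' hst]
      exact key _ _ _ _ (hvs a) (hvs' a)
  have hnot : ((0 : A → ℝ), M.cost w) ∉ C := by
    rintro ⟨v, hv, hvc, hvs⟩
    exact absurd (hw.2 v (feasible_iff.2 ⟨hv, fun a => (hvs a).le⟩)) (not_le.2 hvc)
  obtain ⟨f, hf⟩ := geometric_hahn_banach_open_point hconv hopen hnot
  set α := f (0, 1) with hα
  set β : A → ℝ := fun a => f (Pi.single a 1, 0) with hβ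
  have hfexp : ∀ (s : A → ℝ) (r : ℝ), f (s, r) = ∑ a, s a * β a + r * α := by
    intro s r
    have : ((s, r) : (A → ℝ) × ℝ) = ∑ a, s a • ((Pi.single a 1, 0) : (A → ℝ) × ℝ) +
        r • ((0, 1) : (A → ℝ) × ℝ) := by
      ext b
      · simp [Prod.fst_sum, Finset.sum_apply, Pi.single_apply]
      · simp [Prod.snd_sum]
    rw [this, map_add, map_sum]
    simp only [map_smul, smul_eq_mul, hα, hβ]
  have hmem : ∀ v : (Fin n → X) → ℝ, M.IsContract v → ∀ s : A → ℝ, (∀ a, 0 < s a) →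
      ∀ r : ℝ, 0 < r → ∑ a, (M.slack v a - s a) * β a + (M.cost v + r) * α <
        M.cost w * α := by
    intro v hv s hs r hr
    have := hf (fun a => M.slack v a - s a, M.cost v + r)
      ⟨v, hv, by simpa using hr, fun a => by simpa using hs a⟩
    rw [hfexp, hfexp] at this
    simpa using this
  -- `C` is unbounded towards higher cost, and likewise towards lower slack; this fixes the signs of
  -- the separating functional.
  have hα0 : α ≤ 0 := by
    refine nonpos_of_forall_add_mul_lt
      (x := ∑ a, (M.slack z a - 1) * β a + M.cost z * α) (y := M.cost w * α) fun r hr => ?_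
    have := hmem z hz (fun _ => 1) (fun _ => one_pos) r hr
    linarith
  have hβ0 : ∀ b, 0 ≤ β b := by
    intro b
    refine neg_nonpos.1 (nonpos_of_forall_add_mul_lt
      (x := ∑ a, (M.slack z a - 1) * β a + (M.cost z + 1) * α) (y := M.cost w * α)
      fun r hr => ?_)
    have := hmem z hz (fun a => 1 + (if a = b then r else 0))
      (fun a => by split_ifs <;> linarith) 1 one_pos
    have e : ∑ a, (M.slack z a - (1 + if a = b then r else 0)) * β a =
        ∑ a, (M.slack z a - 1) * β a - r * β b := by
      rw [eq_sub_iff_add_eq, show r * β b = ∑ a, if a = b then r * β a else 0 by simp,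
        ← Finset.sum_add_distrib]
      refine Finset.sum_congr rfl fun a _ => ?_
      split_ifs <;> ring
    rw [e] at this
    linarith
  have hlim : ∀ v : (Fin n → X) → ℝ, M.IsContract v →
      ∑ a, M.slack v a * β a + M.cost v * α ≤ M.cost w * α := by
    intro v hv
    refine le_of_forall_pos_le_add fun ε hε => ?_
    set S := ∑ a, β a with hS
    have hS0 : 0 ≤ S := Finset.sum_nonneg fun a _ => hβ0 a
    -- Lowering every slack and raising the cost by `δ` loses `δ * (S - α)`; the extra `1` only
    -- keeps the denominator positive.
    have hδ : 0 < ε / (S - α + 1) := by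
      have : 0 < S - α + 1 := by linarith
      positivity
    have := hmem v hv (fun _ => ε / (S - α + 1)) (fun _ => hδ) _ hδ
    simp only [sub_mul, Finset.sum_sub_distrib, ← Finset.mul_sum] at this
    have e : ε / (S - α + 1) * (S - α + 1) = ε :=
      div_mul_cancel₀ _ (by linarith)
    nlinarith
  -- Slater's condition: if `α = 0`, the positive slacks of `z` force `β = 0`, and a zero functional
  -- cannot separate strictly.
  have hαneg : α < 0 := by
    refine lt_of_le_of_ne hα0 fun h0 => ?_
    have h1 := hlim z hz
    rw [h0, mul_zero, mul_zero, add_zero] at h1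
    have h2 : ∀ a ∈ Finset.univ, 0 ≤ M.slack z a * β a :=
      fun a _ => mul_nonneg (hzs a).le (hβ0 a)
    have h3 := (Finset.sum_eq_zero_iff_of_nonneg h2).1 (le_antisymm h1 (Finset.sum_nonneg h2))
    have h4 : ∀ a, β a = 0 := fun a => by
      have := h3 a (Finset.mem_univ a)
      exact (mul_eq_zero.1 this).resolve_left (hzs a).ne'
    have := hmem z hz (fun _ => 1) (fun _ => one_pos) 1 one_pos
    simp [h0, h4] at this
  refine ⟨fun a => β a / (-α), fun a => div_nonneg (hβ0 a) (by linarith), fun v hv => ?_⟩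
  have h1 := hlim v hv
  have e : ∑ a, β a / (-α) * M.slack v a = (∑ a, M.slack v a * β a) / (-α) := by
    rw [Finset.sum_div]
    exact Finset.sum_congr rfl fun a _ => by ring
  have hα' : 0 < -α := by linarith
  rw [e, ← le_sub_iff_add_le', div_le_iff₀ hα']
  linarith

/-- Complementary slackness: tested against `w` itself, the Lagrangian inequality leaves a
nonpositive sum of nonnegative terms. -/
theorem IsMultiplier.sum_mul_slack_eq_zero [Fintype A] {w : (Fin n → X) → ℝ} {l : A → ℝ}
    (hl : M.IsMultiplier w l) (hw : M.Feasible w) : ∀ a, l a * M.slack w a = 0 := by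
  obtain ⟨hwc, hws⟩ := feasible_iff.1 hw
  have h1 := hl.le_cost w hwc
  have h2 : ∀ a ∈ Finset.univ, 0 ≤ l a * M.slack w a :=
    fun a _ => mul_nonneg (hl.nonneg a) (hws a)
  intro a
  exact (Finset.sum_eq_zero_iff_of_nonneg h2).1
    (le_antisymm (by linarith) (Finset.sum_nonneg h2)) a (Finset.mem_univ a)

/-- The shadow value of utility at signals with score `L`. -/
noncomputable def shadowValue [Fintype A] [Fintype M.Deviation] (n : ℕ) (l : A → ℝ)
    (L : M.Score) : ℝ :=
  ∑ a, l a - ∑ a : M.Deviation, l a * Real.exp (-(n * L a))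

theorem measurable_shadowValue [Fintype A] [Fintype M.Deviation] (l : A → ℝ) :
    Measurable (shadowValue (M := M) n l) := by
  unfold shadowValue
  fun_prop

theorem shadowValue_le [Fintype A] [Fintype M.Deviation] {l : A → ℝ} (hl : ∀ a, 0 ≤ l a)
    (L : M.Score) : shadowValue n l L ≤ ∑ a, l a :=
  sub_le_self _ (Finset.sum_nonneg fun a _ => mul_nonneg (hl a) (Real.exp_pos _).le)

/-- An optimal contract pays the utility that minimizes the Lagrangian pointwise. -/
theorem IsMultiplier.ae_eq_bestUtility [Fintype A] [Fintype M.Deviation] (hM : M.Assumptions)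
    (hn : 0 < n) {w : (Fin n → X) → ℝ} {l : A → ℝ} (hl : M.IsMultiplier w l)
    (hw : M.Feasible w) : ∀ᵐ x ∂(M.law n M.target),
      w x = M.bestUtility (shadowValue n l (M.score n x)) := by
  have hwc := (feasible_iff.1 hw).1
  set y : (Fin n → X) → ℝ := fun x => shadowValue n l (M.score n x) with hy
  set Φ : (Fin n → X) → ℝ := fun x => M.bestUtility (y x) with hΦ
  have hym : Measurable y := (measurable_shadowValue l).comp (M.measurable_score n)
  -- The pointwise minimizer is bounded because the shadow value never exceeds the sum of the
  -- multipliers.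
  have hΦc : M.IsContract Φ := hM.isContract_of_le (hM.bestUtility_mono.measurable.comp hym)
    (fun x => hM.bestUtility_mem _) (hM.bestUtility_mem (∑ a, l a))
    (fun x => hM.bestUtility_mono (shadowValue_le hl.nonneg _))
  -- Up to a constant independent of `v`, the Lagrangian is the integral of `h v - y * v` under the
  -- target law.
  have hyv : ∀ v : (Fin n → X) → ℝ, M.IsContract v →
      Integrable (fun x => y x * v x) (M.law n M.target) ∧ ∑ a, l a * M.slack v a =
        ∫ x, y x * v x ∂(M.law n M.target) -
          ((∑ a, l a) * M.c M.target - ∑ a : M.Deviation, l a * M.c a) := by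
    intro v hv
    have hi : ∀ a : M.Deviation, Integrable
        (fun x => l a * (Real.exp (-(n * M.score n x a)) * v x)) (M.law n M.target) :=
      fun a => ((hM.integrable_law_iff hn a v).1 (hv.integrable a)).const_mul _
    have e : (fun x => y x * v x) = fun x => (∑ a, l a) * v x -
        ∑ a : M.Deviation, l a * (Real.exp (-(n * M.score n x a)) * v x) := by
      ext x
      simp only [hy, shadowValue, sub_mul, Finset.sum_mul, mul_assoc]
    rw [e]
    refine ⟨((hv.integrable _).const_mul _).sub (integrable_finsetSum _ fun a _ => hi a), ?_⟩
    rw [integral_sub ((hv.integrable _).const_mul _) (integrable_finsetSum _ fun a _ => hi a),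
      integral_finsetSum _ fun a _ => hi a, sum_mul_slack, integral_const_mul]
    simp only [integral_const_mul, ← hM.integral_law hn, mul_sub, Finset.sum_sub_distrib]
    ring
  obtain ⟨hi, he⟩ := hyv w hwc
  obtain ⟨hiΦ, heΦ⟩ := hyv Φ hΦc
  have h1 := hl.le_cost Φ hΦc
  have h0 : ∑ a, l a * M.slack w a = 0 :=
    Finset.sum_eq_zero fun a _ => hl.sum_mul_slack_eq_zero hw a
  have hge : ∀ x, 0 ≤ (M.h (w x) - y x * w x) - (M.h (Φ x) - y x * Φ x) :=
    fun x => sub_nonneg.2 (hM.bestUtility_le (y x) (hwc.range x))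
  have hint1 := hwc.integrable_cost.sub hi
  have hint2 := hΦc.integrable_cost.sub hiΦ
  have hzero : ∫ x, (M.h (w x) - y x * w x) - (M.h (Φ x) - y x * Φ x) ∂(M.law n M.target) = 0 := by
    refine le_antisymm ?_ (integral_nonneg hge)
    have e1 := integral_sub hint1 hint2
    simp only [Pi.sub_apply] at e1
    rw [e1, integral_sub hwc.integrable_cost hi, integral_sub hΦc.integrable_cost hiΦ]
    simp only [cost] at h1
    linarith
  -- A nonnegative gap with zero integral vanishes a.e., and the pointwise minimizer is unique.
  have hae := (integral_eq_zero_iff_of_nonneg hge (hint1.sub hint2)).1 hzero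
  filter_upwards [hae] with x hx
  by_contra hne
  have := (hM.bestUtility_spec (y x)).2 (w x) (hwc.range x) hne
  simp only [Pi.zero_apply] at hx
  linarith

end Duality

end MoralHazard

namespace MoralHazard

/-! ### Two-level test contracts and bounds on the optimal cost. -/

section TestContracts

variable {A X : Type*} [MeasurableSpace X] {M : MoralHazard A X} {n : ℕ}

theorem Assumptions.u_wmin_lt_c (hM : M.Assumptions) (a : A) : M.u M.wmin < M.c a := by
  obtain ⟨ε, hε, h⟩ := hM.exists_mem_utilities_of_abs_le a
  have h1 := hM.u_wmin_le (h (M.c a - ε) (by rw [sub_sub_cancel_left, abs_neg, abs_of_pos hε]))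
  linarith

open Classical in
/-- The contract which pays `b` on the set `R` and `t` elsewhere. -/
noncomputable def twoLevel (R : Set (Fin n → X)) (b t : ℝ) (x : Fin n → X) : ℝ :=
  if x ∈ R then b else t

theorem twoLevel_eq {Y : Type*} (R : Set (Fin n → Y)) (b t : ℝ) :
    twoLevel R b t = fun x => t - R.indicator (fun _ => t - b) x := by
  ext x
  by_cases hx : x ∈ R <;> simp [twoLevel, hx]

theorem Assumptions.isContract_twoLevel (hM : M.Assumptions) {R : Set (Fin n → X)}
    (hR : MeasurableSet R) {b t : ℝ} (hb : b ∈ M.utilities) (ht : t ∈ M.utilities)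
    (hbt : b ≤ t) : M.IsContract (twoLevel R b t) ∧
      (∀ a, ∫ x, twoLevel R b t x ∂(M.law n a) = t - (t - b) * (M.law n a).real R) ∧
      M.cost (twoLevel R b t) ≤ M.h t := by
  have := hM.isProbabilityMeasure_law n
  have hle : ∀ x, twoLevel R b t x ≤ t := fun x => by
    unfold twoLevel; split_ifs <;> linarith
  have hr : ∀ x, twoLevel R b t x ∈ M.utilities := fun x => by
    unfold twoLevel; split_ifs <;> assumption
  have hm : Measurable (twoLevel R b t) := by
    rw [twoLevel_eq]
    exact measurable_const.sub (measurable_const.indicator hR)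
  have hc := hM.isContract_of_le hm hr ht hle
  refine ⟨hc, fun a => ?_, ?_⟩
  · rw [twoLevel_eq, integral_sub (integrable_const _) ((integrable_const _).indicator hR),
      integral_indicator_const _ hR]
    simp [mul_comm]
  · have := integral_mono hc.integrable_cost (integrable_const (M.h t))
      fun x => hM.h_strictMonoOn.monotoneOn (hr x) ht (hle x)
    simpa [cost] using this

/-- The scores which are bad news about some action in `S`. -/
def rejectionRegion (M : MoralHazard A X) (S : Set M.Deviation) (η : ℝ) (n : ℕ) :
    Set (Fin n → X) :=
  {x | ∃ a ∈ S, M.score n x a ≤ M.meanScore a a + η}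

theorem measurableSet_rejectionRegion [Finite A] (S : Set M.Deviation) (η : ℝ) (n : ℕ) :
    MeasurableSet (M.rejectionRegion S η n) := by
  have : M.rejectionRegion S η n = ⋃ a ∈ S, {x | M.score n x a ≤ M.meanScore a a + η} := by
    ext x
    simp [rejectionRegion]
  rw [this]
  exact (Set.toFinite S).measurableSet_biUnion fun a _ =>
    measurableSet_le (M.measurable_score_apply n a) measurable_const

/-- Union bound over the Chernoff estimates. -/
theorem Assumptions.law_target_rejectionRegion_le [Finite A] (hM : M.Assumptions)
    {S : Set M.Deviation} {k η : ℝ} (hk : ∀ a ∈ S, k ≤ -M.meanScore a a) (hn : 0 < n) :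
    (M.law n M.target).real (M.rejectionRegion S η n) ≤
      Nat.card M.Deviation * Real.exp (-(n * (k - η))) := by
  have := Fintype.ofFinite M.Deviation
  have := hM.isProbabilityMeasure_law n M.target
  have hsub : M.rejectionRegion S η n ⊆ ⋃ a, {x | M.score n x a ≤ -(k - η)} ∩ {_x | a ∈ S} := by
    rintro x ⟨a, ha, hx⟩
    refine mem_iUnion.2 ⟨a, ?_, ha⟩
    have := hk a ha
    simp only [mem_ofPred_eq] at hx ⊢
    linarith
  refine (measureReal_mono hsub).trans ((measureReal_iUnion_fintype_le _).trans ?_)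
  have h : ∀ a ∈ (Finset.univ : Finset M.Deviation), (M.law n M.target).real
      ({x | M.score n x a ≤ -(k - η)} ∩ {_x | a ∈ S}) ≤ Real.exp (-(n * (k - η))) := by
    intro a _
    refine (measureReal_mono inter_subset_left).trans ((hM.law_score_le hn a _).trans_eq ?_)
    rw [mul_neg]
  refine (Finset.sum_le_sum h).trans_eq ?_
  simp

theorem Assumptions.tendsto_law_rejectionRegion [Finite A] (hM : M.Assumptions)
    {S : Set M.Deviation} {η : ℝ} (hη : 0 < η) {a : M.Deviation} (ha : a ∈ S) :
    Tendsto (fun n => (M.law n a).real (M.rejectionRegion S η n)) atTop (𝓝 1) := by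
  have hlim := (hM.tendsto_law_score a a hη).const_sub 1
  rw [sub_zero] at hlim
  refine tendsto_of_tendsto_of_tendsto_of_le_of_le hlim tendsto_const_nhds (fun n => ?_)
    fun n => ?_
  · have := hM.isProbabilityMeasure_law n a
    have h1 := probReal_compl_eq_one_sub (μ := M.law n a)
      (measurableSet_rejectionRegion S η n)
    have h2 : (M.law n a).real (M.rejectionRegion S η n)ᶜ ≤
        (M.law n a).real {x | η ≤ |M.score n x a - M.meanScore a a|} := by
      refine measureReal_mono fun x hx => ?_
      simp only [rejectionRegion, mem_compl_iff, mem_ofPred_eq, not_exists, not_and, not_le] at hx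
      have := hx a ha
      simp only [mem_ofPred_eq]
      exact (by linarith : η ≤ M.score n x a - M.meanScore a a).trans (le_abs_self _)
    simp only
    linarith
  · have := hM.isProbabilityMeasure_law n a
    exact measureReal_le_one

theorem tendsto_const_mul_exp_neg_nat_mul (C : ℝ) {r : ℝ} (hr : 0 < r) :
    Tendsto (fun n : ℕ => C * Real.exp (-(n * r))) atTop (𝓝 0) := by
  have h : Tendsto (fun n : ℕ => Real.exp (-(n * r))) atTop (𝓝 0) :=
    Real.tendsto_exp_neg_atTop_nhds_zero.comp
      (tendsto_natCast_atTop_atTop.atTop_mul_const hr)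
  simpa using h.const_mul C

theorem Assumptions.exists_rate [Finite A] (hM : M.Assumptions) :
    ∃ k : ℝ, 0 < k ∧ ∀ a : M.Deviation, k ≤ -M.meanScore a a := by
  rcases isEmpty_or_nonempty M.Deviation with h | h
  · exact ⟨1, one_pos, fun a => isEmptyElim a⟩
  · obtain ⟨a, ha⟩ := Finite.exists_min fun a : M.Deviation => -M.meanScore a a
    exact ⟨_, neg_pos.2 (hM.klDiv_deviation a).1, ha⟩

/-- Some contracts leave slack in all constraints and cost little more than the first best. -/
theorem Assumptions.exists_slater [Finite A] (hM : M.Assumptions) :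
    ∃ δ : ℝ, 0 < δ ∧ ∀ t ∈ M.utilities, M.c M.target < t → ∀ᶠ n in atTop,
      ∃ z : (Fin n → X) → ℝ, M.IsContract z ∧ (0 < M.slack z M.target) ∧
        (∀ a : M.Deviation, δ ≤ M.slack z a) ∧ M.cost z ≤ M.h t := by
  obtain ⟨k, hk, hka⟩ := hM.exists_rate
  have : Nonempty A := ⟨M.target⟩
  obtain ⟨a₀, ha₀⟩ := Finite.exists_min M.c
  -- A deviator is almost surely caught in the limit and gets `u(wmin)`, so its slack tends to `(t -
  -- c(a*)) - (u(wmin) - c(a))`, which exceeds this `δ` for every `a`, independently of `t`.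
  refine ⟨M.c a₀ - M.u M.wmin, sub_pos.2 (hM.u_wmin_lt_c a₀), fun t ht hct => ?_⟩
  set R := M.rejectionRegion univ (k / 2) with hR
  set b := M.u M.wmin with hb
  have hP : Tendsto (fun n => (M.law n M.target).real (R n)) atTop (𝓝 0) := by
    refine squeeze_zero' (Eventually.of_forall fun n => measureReal_nonneg)
      ((eventually_gt_atTop 0).mono fun n hn => hM.law_target_rejectionRegion_le
        (fun a _ => hka a) hn)
      (tendsto_const_mul_exp_neg_nat_mul _ (by linarith))
  have hQ : ∀ a : M.Deviation, Tendsto (fun n => (M.law n a).real (R n)) atTop (𝓝 1) :=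
    fun a => hM.tendsto_law_rejectionRegion (by linarith) (mem_univ a)
  have h1 : Tendsto (fun n => t - (t - b) * (M.law n M.target).real (R n) - M.c M.target) atTop
      (𝓝 (t - M.c M.target)) := by
    simpa using ((hP.const_mul (t - b)).const_sub t).sub_const (M.c M.target)
  have h2 : ∀ a : M.Deviation, Tendsto (fun n => (t - (t - b) * (M.law n M.target).real (R n)
      - M.c M.target) - (t - (t - b) * (M.law n a).real (R n) - M.c a)) atTop
      (𝓝 ((t - M.c M.target) - (b - M.c a))) := fun a => by
    have := h1.sub ((((hQ a).const_mul (t - b)).const_sub t).sub_const (M.c a))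
    simpa using this
  have h1' := h1.eventually_const_lt (sub_pos.2 hct)
  have h2' := fun a : M.Deviation => (h2 a).eventually_const_le (u := M.c a₀ - b) (by
    have := ha₀ a
    linarith)
  filter_upwards [h1', eventually_all.2 h2'] with n hn1 hn2
  obtain ⟨hc, hi, hcost⟩ := hM.isContract_twoLevel
    (measurableSet_rejectionRegion (M := M) univ (k / 2) n) u_wmin_mem ht
    ((hM.u_wmin_lt_c M.target).le.trans hct.le)
  refine ⟨_, hc, ?_, fun a => ?_, hcost⟩
  · rw [slack_target, hi]
    exact hn1
  · rw [slack_deviation, hi, hi]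
    exact hn2 a

/-- Integrate the tangent of `h` at `c(a*)`: individual rationality makes the linear term
nonnegative, and `β` is the convexity loss on low payments. -/
theorem Assumptions.cost_ge (hM : M.Assumptions) {w : (Fin n → X) → ℝ} (hw : M.Feasible w)
    {t₁ β : ℝ} (hβ : ∀ s ∈ M.utilities, s ≤ t₁ →
      M.h (M.c M.target) + M.marginalCost (M.c M.target) * (s - M.c M.target) + β ≤ M.h s) :
    M.h (M.c M.target) + β * (M.law n M.target).real {x | w x ≤ t₁} ≤ M.cost w := by
  have := hM.isProbabilityMeasure_law n M.target
  set c := M.c M.target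
  have hset : MeasurableSet {x | w x ≤ t₁} := measurableSet_le hw.measurable measurable_const
  have hi0 : Integrable (fun x => w x - c) (M.law n M.target) :=
    (hw.integrable _).sub (integrable_const _)
  have hi1 : Integrable (fun x => M.h c + M.marginalCost c * (w x - c)) (M.law n M.target) :=
    (integrable_const _).add (hi0.const_mul _)
  have hi2 : Integrable ({x | w x ≤ t₁}.indicator fun _ => β) (M.law n M.target) :=
    (integrable_const β).indicator hset
  have hle : ∀ x, (M.h c + M.marginalCost c * (w x - c)) +
      {x | w x ≤ t₁}.indicator (fun _ => β) x ≤ M.h (w x) := by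
    intro x
    by_cases hx : w x ≤ t₁
    · rw [indicator_of_mem (by exact hx)]
      exact hβ _ (hw.range x) hx
    · rw [indicator_of_notMem (by exact hx), add_zero]
      exact hM.tangent_le_h (hM.cost_mem _) (hw.range x)
  have h1 := integral_mono (hi1.add hi2) hw.integrable_cost hle
  rw [integral_add' hi1 hi2, integral_indicator_const _ hset,
    integral_add (integrable_const _) (hi0.const_mul _),
    integral_const_mul, integral_sub (hw.integrable _) (integrable_const _)] at h1
  have h2 := mul_nonneg (hM.marginalCost_pos (hM.cost_mem M.target)).le hw.ir
  simp only [integral_const, probReal_univ, smul_eq_mul, one_mul] at h1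
  rw [mul_comm β]
  change _ ≤ M.cost w at h1
  linarith

theorem Assumptions.h_cost_le_cost (hM : M.Assumptions) {w : (Fin n → X) → ℝ}
    (hw : M.Feasible w) : M.h (M.c M.target) ≤ M.cost w := by
  have := hM.cost_ge hw (t₁ := 0) (β := 0) fun s hs _ => by
    rw [add_zero]
    exact hM.tangent_le_h (hM.cost_mem _) hs
  simpa using this

/-- Upper bound on the cost of optimal contracts in excess of the first best. -/
theorem Assumptions.exists_cost_le [Finite A] (hM : M.Assumptions) {k η : ℝ}
    (hk : ∀ a : M.Deviation, M.c a < M.c M.target → k ≤ -M.meanScore a a)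
    (hη : 0 < η) (hηk : η < k) : ∃ C : ℝ, 0 ≤ C ∧ ∀ᶠ n in atTop, ∀ w : (Fin n → X) → ℝ,
      M.IsOptimal w → M.cost w ≤ M.h (M.c M.target) + C * Real.exp (-(n * (k - η))) := by
  obtain ⟨ε₀, hε₀, hε₀I⟩ := hM.exists_mem_utilities_of_abs_le M.target
  set c := M.c M.target with hc
  set b := M.u M.wmin with hb
  have hbc : b < c := hM.u_wmin_lt_c M.target
  set S : Set M.Deviation := {a | M.c a < M.c M.target} with hS
  set R := M.rejectionRegion S η with hR
  set D := c + ε₀ - b with hD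
  have hD0 : 0 < D := by linarith
  set p : ℕ → ℝ := fun n => Nat.card M.Deviation * Real.exp (-(n * (k - η))) with hp
  have hp0 : ∀ n, 0 ≤ p n := fun n => by positivity
  have hplim : Tendsto p atTop (𝓝 0) := tendsto_const_mul_exp_neg_nat_mul _ (sub_pos.2 hηk)
  -- The reward exceeds `c` by just enough to offset a loss of at most `D` with probability at most
  -- `p n`, preserving individual rationality.
  set t : ℕ → ℝ := fun n => c + D * p n with ht
  have htlim : Tendsto t atTop (𝓝 c) := by simpa using (hplim.const_mul D).const_add c
  have htI : c + ε₀ ∈ M.utilities := hε₀I _ (by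
    rw [add_sub_cancel_left, abs_of_pos hε₀])
  refine ⟨M.marginalCost (c + ε₀) * D * Nat.card M.Deviation, by
    have := (hM.marginalCost_pos htI).le
    positivity, ?_⟩
  -- Cheaper deviations are caught with probability tending to one; costlier ones are unattractive
  -- even at the full reward `t n`.
  have hIC : ∀ a : M.Deviation, ∀ᶠ n in atTop,
      t n - (t n - b) * (M.law n a).real (R n) - M.c a ≤ 0 := by
    intro a
    rcases (hM.cost_ne a a.2).lt_or_gt with ha | ha
    · have hQ := hM.tendsto_law_rejectionRegion hη (S := S) ha
      have : Tendsto (fun n => t n - (t n - b) * (M.law n a).real (R n) - M.c a) atTop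
          (𝓝 (b - M.c a)) := by
        have := (htlim.sub ((htlim.sub_const b).mul hQ)).sub_const (M.c a)
        simpa using this
      exact this.eventually_le_const (sub_neg.2 (hM.u_wmin_lt_c a))
    · filter_upwards [htlim.eventually_le_const (show c < M.c a from ha),
        htlim.eventually_const_le hbc] with n h1 h2
      have := mul_nonneg (sub_nonneg.2 h2) (measureReal_nonneg (μ := M.law n a) (s := R n))
      linarith
  filter_upwards [eventually_all.2 hIC, eventually_gt_atTop 0,
    htlim.eventually_le_const (show c < c + ε₀ by linarith)] with n hn1 hn hn2 w hw
  have htc : c ≤ t n := le_add_of_nonneg_right (mul_nonneg hD0.le (hp0 n))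
  have htnI : t n ∈ M.utilities :=
    hM.ordConnected_utilities.out (hM.cost_mem M.target) htI ⟨htc, hn2⟩
  obtain ⟨hv, hi, hcost⟩ := hM.isContract_twoLevel
    (measurableSet_rejectionRegion S η n) u_wmin_mem htnI (hbc.le.trans htc)
  have hP : (M.law n M.target).real (R n) ≤ p n :=
    hM.law_target_rejectionRegion_le (fun a ha => hk a ha) hn
  have hir : 0 ≤ t n - (t n - b) * (M.law n M.target).real (R n) - c := by
    have h1 : (t n - b) * (M.law n M.target).real (R n) ≤ D * p n :=
      mul_le_mul (by linarith) hP measureReal_nonneg hD0.le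
    simp only [ht]
    simp only [ht] at h1
    linarith
  have hfeas : M.Feasible (twoLevel (R n) b (t n)) := by
    refine feasible_iff.2 ⟨hv, fun a => ?_⟩
    by_cases ha : a = M.target
    · rw [ha, slack_target, hi]
      exact hir
    · have := slack_deviation (twoLevel (R n) b (t n)) (⟨a, ha⟩ : M.Deviation)
      simp only at this
      rw [this, hi, hi]
      have := hn1 ⟨a, ha⟩
      simp only at this
      linarith
  have h1 := hM.tangent_le_h htnI (hM.cost_mem M.target)
  have h2 := hM.marginalCost_strictMonoOn.monotoneOn htnI htI hn2
  have h3 : M.marginalCost (t n) * (t n - c) ≤ M.marginalCost (c + ε₀) * (D * p n) := by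
    rw [show t n - c = D * p n by simp [ht]]
    exact mul_le_mul_of_nonneg_right h2 (mul_nonneg hD0.le (hp0 n))
  have h4 : M.marginalCost (c + ε₀) * (D * p n) =
      M.marginalCost (c + ε₀) * D * Nat.card M.Deviation * Real.exp (-(n * (k - η))) := by
    simp only [hp]
    ring
  have h5 := (hw.2 _ hfeas).trans hcost
  rw [← h4]
  linarith

/-- Under the target action, optimal contracts rarely pay much less than the first best. -/
theorem Assumptions.exists_law_le [Finite A] (hM : M.Assumptions) {k η : ℝ}
    (hk : ∀ a : M.Deviation, M.c a < M.c M.target → k ≤ -M.meanScore a a)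
    (hη : 0 < η) (hηk : η < k) {t₁ : ℝ} (ht₁ : t₁ ∈ M.utilities) (hlt : t₁ < M.c M.target) :
    ∃ C : ℝ, ∀ᶠ n in atTop, ∀ w : (Fin n → X) → ℝ, M.IsOptimal w →
      (M.law n M.target).real {x | w x ≤ t₁} ≤ C * Real.exp (-(n * (k - η))) := by
  obtain ⟨C, _, h⟩ := hM.exists_cost_le hk hη hηk
  obtain ⟨β, hβ, hβs⟩ := hM.exists_bregman_lower_bound (hM.cost_mem M.target) ht₁ hlt
  refine ⟨C / β, h.mono fun n hn w hw => ?_⟩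
  have h1 := hM.cost_ge hw.1 hβs
  have h2 := hn w hw
  rw [div_mul_eq_mul_div, le_div_iff₀ hβ]
  linarith

end TestContracts

end MoralHazard

namespace MoralHazard

/-! ### Limits of the multipliers. -/

section Multipliers

variable {A X : Type*} [MeasurableSpace X] {M : MoralHazard A X}

/-- Along a sequence of optimal contracts `w`, `l` is a sequence of multipliers. -/
def AreMultipliers [Fintype A] (M : MoralHazard A X) (w : ∀ n, (Fin n → X) → ℝ)
    (l : ℕ → A → ℝ) : Prop :=
  ∀ᶠ n in atTop, M.IsOptimal (w n) ∧ M.IsMultiplier (w n) (l n)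

theorem Assumptions.exists_areMultipliers [Fintype A] (hM : M.Assumptions)
    {w : ∀ n, (Fin n → X) → ℝ} (hw : ∀ᶠ n in atTop, M.IsOptimal (w n)) :
    ∃ l : ℕ → A → ℝ, M.AreMultipliers w l := by
  obtain ⟨δ, hδ, hz⟩ := hM.exists_slater
  obtain ⟨ε₀, hε₀, hI⟩ := hM.exists_mem_utilities_of_abs_le M.target
  have h := hz (M.c M.target + ε₀) (hI _ (by rw [add_sub_cancel_left, abs_of_pos hε₀]))
    (by linarith)
  have hex : ∀ᶠ n in atTop, ∃ l : A → ℝ, M.IsMultiplier (w n) l := by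
    filter_upwards [hw, h] with n hn ⟨z, hzc, hz0, hza, _⟩
    refine hM.exists_multipliers hn hzc fun a => ?_
    by_cases ha : a = M.target
    · rwa [ha]
    · exact hδ.trans_le (hza ⟨a, ha⟩)
  obtain ⟨l, hl⟩ := hex.choice
  exact ⟨l, hw.and hl⟩

namespace AreMultipliers

variable [Fintype A] {w : ∀ n, (Fin n → X) → ℝ} {l : ℕ → A → ℝ}

/-- A Slater contract with slack at least `δ` can cost arbitrarily little more than the first best,
and `l n a * δ` is bounded by that excess. -/
theorem tendsto_zero (hM : M.Assumptions) (hl : M.AreMultipliers w l) (a : M.Deviation) :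
    Tendsto (fun n => l n a) atTop (𝓝 0) := by
  classical
  obtain ⟨δ, hδ, hz⟩ := hM.exists_slater
  obtain ⟨ε₀, hε₀, hI⟩ := hM.exists_mem_utilities_of_abs_le M.target
  set c := M.c M.target with hc
  have hcI : c ∈ M.utilities := hM.cost_mem _
  have hcε : c + ε₀ ∈ M.utilities := hI _ (by rw [add_sub_cancel_left, abs_of_pos hε₀])
  set q := M.marginalCost (c + ε₀) with hq
  have hq0 : 0 < q := hM.marginalCost_pos hcε
  refine tendsto_order.2 ⟨fun x hx => ?_, fun x hx => ?_⟩
  · filter_upwards [hl] with n hn using hx.trans_le (hn.2.nonneg a)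
  -- The excess cost is at most `q * d ≤ x * δ / 2`, leaving `l n a ≤ x / 2`.
  set d := min ε₀ (x * δ / (2 * q)) with hd
  have hd0 : 0 < d := lt_min hε₀ (by positivity)
  have htI : c + d ∈ M.utilities := hM.ordConnected_utilities.out hcI hcε
    ⟨by linarith, by linarith [min_le_left ε₀ (x * δ / (2 * q))]⟩
  filter_upwards [hl, hz (c + d) htI (by linarith)] with n hn ⟨z, hzc, hz0, hza, hzcost⟩
  have h1 := hn.2.le_cost z hzc
  have h2 := hM.h_cost_le_cost hn.1.1
  have h3 := hM.tangent_le_h htI hcI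
  have h4 : M.marginalCost (c + d) ≤ q := hM.marginalCost_strictMonoOn.monotoneOn htI hcε
    (by linarith [min_le_left ε₀ (x * δ / (2 * q))])
  have h5 : l n a * M.slack z a ≤ ∑ b, l n b * M.slack z b := by
    refine Finset.single_le_sum (f := fun b => l n b * M.slack z b) (fun b _ => ?_)
      (Finset.mem_univ (a : A))
    refine mul_nonneg (hn.2.nonneg b) ?_
    by_cases hb : b = M.target
    · rw [hb]; exact hz0.le
    · exact hδ.le.trans (hza ⟨b, hb⟩)
  have h6 : l n a * δ ≤ l n a * M.slack z a :=
    mul_le_mul_of_nonneg_left (hza a) (hn.2.nonneg a)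
  have h7 : q * d ≤ x * δ / 2 := by
    calc q * d ≤ q * (x * δ / (2 * q)) :=
          mul_le_mul_of_nonneg_left (min_le_right _ _) hq0.le
      _ = x * δ / 2 := by field_simp
  have h8 : M.marginalCost (c + d) * d ≤ q * d := mul_le_mul_of_nonneg_right h4 hd0.le
  have h9 : l n a * δ ≤ x * δ / 2 := by
    have : c - (c + d) = -d := by ring
    rw [this] at h3
    linarith
  nlinarith [mul_pos hx hδ]

/-- The Lagrangian tested with the constant contract `t`; the deviation terms form the error `e`.
Taking `t` on either side of `c(a*)` traps the sum of the multipliers near `h'(c(a*))`. -/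
theorem sum_mul_le (hM : M.Assumptions) (hl : M.AreMultipliers w l) {t : ℝ}
    (ht : t ∈ M.utilities) : ∃ e : ℕ → ℝ, Tendsto e atTop (𝓝 0) ∧ ∀ᶠ n in atTop,
      (∑ a, l n a) * (t - M.c M.target) ≤ M.h t - M.h (M.c M.target) + e n := by
  have := Fintype.ofFinite M.Deviation
  refine ⟨fun n => ∑ a : M.Deviation, l n a * (t - M.c a), ?_, ?_⟩
  · have := tendsto_finsetSum (Finset.univ : Finset M.Deviation)
      fun a _ => (hl.tendsto_zero hM a).mul_const (t - M.c a)
    simpa using this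
  · filter_upwards [hl] with n hn
    have hc : M.IsContract (fun _ : Fin n → X => t) :=
      hM.isContract_of_le measurable_const (fun _ => ht) ht fun _ => le_rfl
    have h1 := hn.2.le_cost _ hc
    have h2 := hM.h_cost_le_cost hn.1.1
    have := hM.isProbabilityMeasure_law n
    rw [sum_mul_slack] at h1
    simp only [cost, integral_const, probReal_univ, smul_eq_mul, one_mul] at h1
    change M.cost (w n) + _ ≤ _ at h1
    linarith

theorem eventually_sum_le (hM : M.Assumptions) (hl : M.AreMultipliers w l) {s : ℝ}
    (hs : s ∈ M.utilities) (hlt : M.c M.target < s) :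
    ∀ᶠ n in atTop, ∑ a, l n a ≤ M.marginalCost s := by
  set c := M.c M.target with hc
  have htI : (c + s) / 2 ∈ M.utilities := hM.ordConnected_utilities.out (hM.cost_mem M.target) hs
    ⟨by linarith, by linarith⟩
  have hq := hM.marginalCost_strictMonoOn htI hs (by linarith)
  obtain ⟨e, he, h⟩ := hl.sum_mul_le hM htI
  have hpos : 0 < (M.marginalCost s - M.marginalCost ((c + s) / 2)) * ((c + s) / 2 - c) :=
    mul_pos (sub_pos.2 hq) (by linarith)
  filter_upwards [h, he.eventually_le_const hpos] with n hn hen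
  have h1 := hM.tangent_le_h htI (hM.cost_mem M.target)
  have hd : 0 < (c + s) / 2 - c := by linarith
  refine le_of_mul_le_mul_right ?_ hd
  linarith

theorem eventually_le_sum (hM : M.Assumptions) (hl : M.AreMultipliers w l) {s : ℝ}
    (hs : s ∈ M.utilities) (hlt : s < M.c M.target) :
    ∃ θ : ℝ, 0 < θ ∧ ∀ᶠ n in atTop, M.marginalCost s + θ ≤ ∑ a, l n a := by
  set c := M.c M.target with hc
  have htI : (c + s) / 2 ∈ M.utilities := hM.ordConnected_utilities.out hs (hM.cost_mem M.target)
    ⟨by linarith, by linarith⟩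
  have hq := hM.marginalCost_strictMonoOn hs htI (by linarith)
  obtain ⟨e, he, h⟩ := hl.sum_mul_le hM htI
  -- Half of the gap in marginal cost is kept as `θ`; the other half absorbs `e n`.
  refine ⟨(M.marginalCost ((c + s) / 2) - M.marginalCost s) / 2, by linarith, ?_⟩
  have hpos : 0 < (M.marginalCost ((c + s) / 2) - M.marginalCost s) / 2 * (c - (c + s) / 2) :=
    mul_pos (by linarith) (by linarith)
  filter_upwards [h, he.eventually_le_const hpos] with n hn hen
  have h1 := hM.tangent_le_h htI (hM.cost_mem M.target)
  have hd : 0 < c - (c + s) / 2 := by linarith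
  refine le_of_mul_le_mul_right ?_ hd
  linarith

theorem eventually_bestUtility_sum_le (hM : M.Assumptions) (hl : M.AreMultipliers w l) {s : ℝ}
    (hlt : M.c M.target < s) : ∀ᶠ n in atTop, M.bestUtility (∑ a, l n a) ≤ s := by
  obtain ⟨ε₀, hε₀, hI⟩ := hM.exists_mem_utilities_of_abs_le M.target
  have hd : 0 < min ε₀ (s - M.c M.target) := lt_min hε₀ (sub_pos.2 hlt)
  have hmem : M.c M.target + min ε₀ (s - M.c M.target) ∈ M.utilities := hI _ (by
    rw [add_sub_cancel_left, abs_of_pos hd]; exact min_le_left _ _)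
  filter_upwards [hl.eventually_sum_le hM hmem (by linarith)] with n hn
  refine (hM.bestUtility_mono hn).trans ?_
  rw [hM.bestUtility_marginalCost hmem]
  linarith [min_le_right ε₀ (s - M.c M.target)]

theorem eventually_le_bestUtility (hM : M.Assumptions) (hl : M.AreMultipliers w l) {s : ℝ}
    (hlt : s < M.c M.target) : ∃ θ : ℝ, 0 < θ ∧ ∀ᶠ n in atTop,
      ∀ y : ℝ, ∑ a, l n a - θ ≤ y → s ≤ M.bestUtility y := by
  obtain ⟨ε₀, hε₀, hI⟩ := hM.exists_mem_utilities_of_abs_le M.target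
  have hd : 0 < min ε₀ (M.c M.target - s) := lt_min hε₀ (sub_pos.2 hlt)
  have hmem : M.c M.target - min ε₀ (M.c M.target - s) ∈ M.utilities := hI _ (by
    rw [sub_sub_cancel_left, abs_neg, abs_of_pos hd]; exact min_le_left _ _)
  obtain ⟨θ, hθ, h⟩ := hl.eventually_le_sum hM hmem (by linarith)
  refine ⟨θ, hθ, h.mono fun n hn y hy => ?_⟩
  have h1 := hM.bestUtility_mono (show M.marginalCost _ ≤ y by linarith)
  rw [hM.bestUtility_marginalCost hmem] at h1
  linarith [min_le_right ε₀ (M.c M.target - s)]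

theorem ae_eq [Fintype M.Deviation] (hM : M.Assumptions) (hl : M.AreMultipliers w l) :
    ∀ᶠ n in atTop, ∀ a, ∀ᵐ x ∂(M.law n a),
      w n x = M.bestUtility (shadowValue n (l n) (M.score n x)) := by
  filter_upwards [hl, eventually_gt_atTop 0] with n hn hn0 a
  exact (hM.law_absolutelyContinuous n M.target a).ae_le
    (hn.2.ae_eq_bestUtility hM hn0 hn.1.1)

theorem eventually_ae_le (hM : M.Assumptions) (hl : M.AreMultipliers w l) {s : ℝ}
    (hlt : M.c M.target < s) : ∀ᶠ n in atTop, ∀ a, ∀ᵐ x ∂(M.law n a), w n x ≤ s := by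
  have := Fintype.ofFinite M.Deviation
  filter_upwards [hl, hl.ae_eq hM, hl.eventually_bestUtility_sum_le hM hlt] with n hn hae hs a
  filter_upwards [hae a] with x hx
  rw [hx]
  exact (hM.bestUtility_mono (shadowValue_le hn.2.nonneg _)).trans hs

theorem eventually_integral_le (hM : M.Assumptions) (hl : M.AreMultipliers w l) {s : ℝ}
    (hlt : M.c M.target < s) :
    ∀ᶠ n in atTop, ∀ a, ∫ x, w n x ∂(M.law n a) ≤ s := by
  filter_upwards [hl, hl.eventually_ae_le hM hlt] with n hn hae a
  have := hM.isProbabilityMeasure_law n a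
  simpa using integral_mono_ae (hn.1.1.integrable a) (integrable_const s) (hae a)

/-- Payments are eventually a.s. below `c(a)`, so a costlier deviation is strictly unprofitable and
complementary slackness applies. -/
theorem eventually_eq_zero (hM : M.Assumptions) (hl : M.AreMultipliers w l) {a : M.Deviation}
    (ha : M.c M.target < M.c a) : ∀ᶠ n in atTop, l n a = 0 := by
  obtain ⟨s, hs1, hs2⟩ := exists_between ha
  filter_upwards [hl, hl.eventually_integral_le hM hs1] with n hn hs
  have h1 := hn.2.sum_mul_slack_eq_zero hn.1.1 a
  refine (mul_eq_zero.1 h1).resolve_right (ne_of_gt ?_)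
  rw [slack_deviation]
  linarith [hs a, hn.1.1.ir]

end AreMultipliers

end Multipliers

/-! ### Exponential rates of the multipliers along subsequences. -/

section Thresholds

variable {A X : Type*} [MeasurableSpace X] {M : MoralHazard A X}

/-- Along the subsequence `φ`, the multipliers `l` grow at the exponential rates `γ`. -/
structure IsThreshold (M : MoralHazard A X) (l : ℕ → A → ℝ) (φ : ℕ → ℕ)
    (γ : M.Deviation → EReal) : Prop where
  tendsto : Tendsto φ atTop atTop
  exp_le : ∀ a (r : ℝ), (r : EReal) < γ a → ∀ᶠ k in atTop, Real.exp (φ k * r) ≤ l (φ k) a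
  le_exp : ∀ a (r : ℝ), γ a < r → ∀ᶠ k in atTop, l (φ k) a ≤ Real.exp (φ k * r)

theorem exists_isThreshold [Finite A] (M : MoralHazard A X) (l : ℕ → A → ℝ)
    (hl : ∀ᶠ n in atTop, ∀ a, 0 ≤ l n a) {φ : ℕ → ℕ} (hφ : Tendsto φ atTop atTop) :
    ∃ (ψ : ℕ → ℕ) (γ : M.Deviation → EReal), StrictMono ψ ∧ M.IsThreshold l (φ ∘ ψ) γ := by
  have := Fintype.ofFinite M.Deviation
  -- A zero multiplier has rate `⊥`; the default `Real.log 0 = 0` would wrongly give rate zero.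
  -- Compactness of `EReal` then provides the subsequence.
  set g : ℕ → M.Deviation → EReal := fun k a =>
    if l (φ k) a = 0 then ⊥ else ((Real.log (l (φ k) a) / φ k : ℝ) : EReal) with hg
  obtain ⟨γ, ψ, hψ, hlim⟩ := CompactSpace.tendsto_subseq g
  have hlim' : ∀ a, Tendsto (fun k => g (ψ k) a) atTop (𝓝 (γ a)) := fun a =>
    (tendsto_pi_nhds.1 hlim a)
  have ht : Tendsto (φ ∘ ψ) atTop atTop := hφ.comp hψ.tendsto_atTop
  refine ⟨ψ, γ, hψ, ht, fun a r hr => ?_, fun a r hr => ?_⟩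
  · filter_upwards [(hlim' a).eventually_const_lt hr, ht.eventually hl,
      ht.eventually (eventually_gt_atTop 0)] with k hk hk0 hkn
    simp only [hg] at hk
    simp only [Function.comp_apply] at hkn hk0 ⊢
    split_ifs at hk with h0
    · exact absurd hk not_lt_bot
    · have hn : (0 : ℝ) < φ (ψ k) := by exact_mod_cast hkn
      have hpos := lt_of_le_of_ne (hk0 a) (Ne.symm h0)
      rw [EReal.coe_lt_coe_iff, lt_div_iff₀ hn] at hk
      rw [← Real.le_log_iff_exp_le hpos]
      linarith
  · filter_upwards [(hlim' a).eventually_lt_const hr, ht.eventually hl,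
      ht.eventually (eventually_gt_atTop 0)] with k hk hk0 hkn
    simp only [hg] at hk
    simp only [Function.comp_apply] at hkn hk0 ⊢
    split_ifs at hk with h0
    · rw [h0]; exact (Real.exp_pos _).le
    · have hn : (0 : ℝ) < φ (ψ k) := by exact_mod_cast hkn
      have hpos := lt_of_le_of_ne (hk0 a) (Ne.symm h0)
      rw [EReal.coe_lt_coe_iff, div_lt_iff₀ hn] at hk
      rw [← Real.log_le_iff_le_exp hpos]
      linarith

namespace IsThreshold

variable [Fintype A] {w : ∀ n, (Fin n → X) → ℝ} {l : ℕ → A → ℝ} {φ : ℕ → ℕ}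
  {γ : M.Deviation → EReal}

theorem le_zero (hM : M.Assumptions) (hl : M.AreMultipliers w l) (hγ : M.IsThreshold l φ γ)
    (a : M.Deviation) : γ a ≤ 0 := by
  by_contra! h
  obtain ⟨k, h1, h2⟩ := ((hγ.exp_le a 0 (by simpa using h)).and
    (hγ.tendsto.eventually ((hl.tendsto_zero hM a).eventually_lt_const one_pos))).exists
  rw [mul_zero, Real.exp_zero] at h1
  linarith

theorem eq_bot (hM : M.Assumptions) (hl : M.AreMultipliers w l) (hγ : M.IsThreshold l φ γ)
    {a : M.Deviation} (ha : M.c M.target < M.c a) : γ a = ⊥ := by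
  by_contra! h
  obtain ⟨r, _, hr⟩ := EReal.lt_iff_exists_real_btwn.1 (bot_lt_iff_ne_bot.2 h)
  obtain ⟨k, h1, h2⟩ := ((hγ.exp_le a r hr).and
    (hγ.tendsto.eventually (hl.eventually_eq_zero hM ha))).exists
  rw [h2] at h1
  exact absurd h1 (not_le.2 (Real.exp_pos _))

/-- Each deviation term is at most `exp (-n η)` uniformly near `m`, so the shadow value stays within
`θ` of the sum of the multipliers. -/
theorem eventually_le_bestUtility [Fintype M.Deviation] (hM : M.Assumptions)
    (hl : M.AreMultipliers w l) (hγ : M.IsThreshold l φ γ) {m : M.Score}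
    (hm : ∀ a, γ a < m a) : ∃ η : ℝ, 0 < η ∧ ∀ s < M.c M.target, ∀ᶠ k in atTop,
      ∀ L : M.Score, (∀ a, |L a - m a| < η) →
        s ≤ M.bestUtility (shadowValue (φ k) (l (φ k)) L) := by
  choose r hr1 hr2 using fun a => EReal.lt_iff_exists_real_btwn.1 (hm a)
  -- With half the gap, every `L` within `η` of `m` still exceeds `r` by `η`.
  obtain ⟨η, hη, hηr⟩ : ∃ η : ℝ, 0 < η ∧ ∀ a, η ≤ (m a - r a) / 2 := by
    rcases isEmpty_or_nonempty M.Deviation with h | h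
    · exact ⟨1, one_pos, fun a => isEmptyElim a⟩
    · obtain ⟨a, ha⟩ := Finite.exists_min fun a : M.Deviation => (m a - r a) / 2
      have := EReal.coe_lt_coe_iff.1 (hr2 a)
      exact ⟨_, by linarith, ha⟩
  refine ⟨η, hη, fun s hs => ?_⟩
  obtain ⟨θ, hθ, h⟩ := hl.eventually_le_bestUtility hM hs
  have hsmall := (tendsto_const_mul_exp_neg_nat_mul (Fintype.card M.Deviation : ℝ)
    hη).eventually_le_const hθ
  filter_upwards [hγ.tendsto.eventually h, hγ.tendsto.eventually hsmall,
    eventually_all.2 fun a => hγ.le_exp a (r a) (hr1 a)] with k hk hks hkr L hL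
  refine hk _ (sub_le_sub_left (le_trans ?_ hks) _)
  rw [← nsmul_eq_mul, ← Finset.card_univ]
  refine Finset.sum_le_card_nsmul _ _ _ fun a _ => ?_
  refine (mul_le_mul_of_nonneg_right (hkr a) (Real.exp_pos _).le).trans ?_
  rw [← Real.exp_add, Real.exp_le_exp]
  have h1 := (abs_lt.1 (hL a)).1
  have h2 := hηr a
  have h3 : (0 : ℝ) ≤ φ k := Nat.cast_nonneg _
  nlinarith

/-- The single term of `a` grows like `exp (n (r' - r))` and overtakes the bounded sum of
multipliers, so the shadow value becomes nonpositive. -/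
theorem eventually_bestUtility_eq [Fintype M.Deviation] (hM : M.Assumptions)
    (hl : M.AreMultipliers w l) (hγ : M.IsThreshold l φ γ) {a : M.Deviation} {r : ℝ}
    (hr : r < γ a) : ∀ᶠ k in atTop, ∀ L : M.Score, L a ≤ r →
      M.bestUtility (shadowValue (φ k) (l (φ k)) L) = M.u M.wmin := by
  obtain ⟨r', hr1, hr2⟩ := EReal.lt_iff_exists_real_btwn.1 hr
  rw [EReal.coe_lt_coe_iff] at hr1
  obtain ⟨ε₀, hε₀, hI⟩ := hM.exists_mem_utilities_of_abs_le M.target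
  have hmem : M.c M.target + ε₀ ∈ M.utilities := hI _ (by
    rw [add_sub_cancel_left, abs_of_pos hε₀])
  have hsum := hγ.tendsto.eventually (hl.eventually_sum_le hM hmem (by linarith))
  have hbig : Tendsto (fun k => Real.exp (φ k * (r' - r))) atTop atTop :=
    Real.tendsto_exp_atTop.comp (((tendsto_natCast_atTop_atTop).comp
      hγ.tendsto).atTop_mul_const (sub_pos.2 hr1))
  filter_upwards [hsum, hbig.eventually_ge_atTop (M.marginalCost (M.c M.target + ε₀)),
    hγ.exp_le a r' hr2, hγ.tendsto.eventually hl] with k h1 h2 h3 h4 L hL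
  refine hM.bestUtility_of_nonpos ?_
  have h5 : l (φ k) a * Real.exp (-(φ k * L a)) ≤
      ∑ b : M.Deviation, l (φ k) b * Real.exp (-(φ k * L b)) :=
    Finset.single_le_sum (f := fun b : M.Deviation => l (φ k) b * Real.exp (-(φ k * L b)))
      (fun b _ => mul_nonneg (h4.2.nonneg b) (Real.exp_pos _).le) (Finset.mem_univ a)
  have h6 : Real.exp (φ k * (r' - r)) ≤ l (φ k) a * Real.exp (-(φ k * L a)) := by
    refine le_trans ?_ (mul_le_mul_of_nonneg_right h3 (Real.exp_pos _).le)
    rw [← Real.exp_add, Real.exp_le_exp]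
    have : (0 : ℝ) ≤ φ k := Nat.cast_nonneg _
    nlinarith
  rw [shadowValue]
  linarith

end IsThreshold

end Thresholds

end MoralHazard

namespace MoralHazard

/-! ### Pointwise limits of contracts and the large deviation bound. -/

section Asymptotics

variable {A X : Type*} [MeasurableSpace X] {M : MoralHazard A X}

namespace IsThreshold

variable [Fintype A] {l : ℕ → A → ℝ} {φ : ℕ → ℕ} {γ : M.Deviation → EReal}

/-- The explicit form of the contract holds only a.e. at realized scores; interpolation brackets `v
n L` between payments at nearby realized scores. -/
theorem tendsto_target (hM : M.Assumptions) {v : ℕ → M.Score → ℝ}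
    (hl : M.AreMultipliers (fun n x => v n (M.score n x)) l)
    (hγ : M.IsThreshold l φ γ) {L : M.Score}
    (hL : ∀ ε : ℝ, 0 < ε → ∀ᶠ n in atTop,
      (∃ᵐ x ∂(M.law n M.target),
        (∀ a, |M.score n x a - L a| < ε) ∧ v n (M.score n x) < v n L + ε) ∧
      (∃ᵐ x ∂(M.law n M.target),
        (∀ a, |M.score n x a - L a| < ε) ∧ v n L - ε < v n (M.score n x)))
    (hLγ : ∀ a, γ a < L a) : Tendsto (fun k => v (φ k) L) atTop (𝓝 (M.c M.target)) := by
  have := Fintype.ofFinite M.Deviation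
  obtain ⟨η, hη, hlow⟩ := hγ.eventually_le_bestUtility hM hl hLγ
  rw [Metric.tendsto_nhds]
  intro δ hδ
  have hε : 0 < min η (δ / 4) := lt_min hη (by linarith)
  have hε2 := min_le_right η (δ / 4)
  filter_upwards [hγ.tendsto.eventually (hL _ hε), hγ.tendsto.eventually (hl.ae_eq hM),
    hlow (M.c M.target - δ / 4) (by linarith), hγ.tendsto.eventually
      (hl.eventually_ae_le hM (show M.c M.target < M.c M.target + δ / 4 by linarith))]
    with k ⟨h1, h2⟩ h3 h4 h5
  obtain ⟨x, ⟨hx1, hx2⟩, hx3⟩ := (h1.and_eventually (h3 M.target)).exists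
  obtain ⟨x', ⟨_, hx2'⟩, hx3'⟩ := (h2.and_eventually (h5 M.target)).exists
  have h6 := h4 (M.score (φ k) x) fun a => (hx1 a).trans_le (min_le_left _ _)
  rw [← hx3] at h6
  rw [Real.dist_eq, abs_lt]
  constructor <;> linarith

theorem tendsto_u_wmin (hM : M.Assumptions) {v : ℕ → M.Score → ℝ}
    (hl : M.AreMultipliers (fun n x => v n (M.score n x)) l)
    (hγ : M.IsThreshold l φ γ) {L : M.Score}
    (hL : ∀ ε : ℝ, 0 < ε → ∀ᶠ n in atTop,
      (∃ᵐ x ∂(M.law n M.target),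
        (∀ a, |M.score n x a - L a| < ε) ∧ v n (M.score n x) < v n L + ε) ∧
      (∃ᵐ x ∂(M.law n M.target),
        (∀ a, |M.score n x a - L a| < ε) ∧ v n L - ε < v n (M.score n x)))
    (hLγ : ∃ a, L a < γ a) : Tendsto (fun k => v (φ k) L) atTop (𝓝 (M.u M.wmin)) := by
  have := Fintype.ofFinite M.Deviation
  obtain ⟨a, ha⟩ := hLγ
  obtain ⟨r, hr1, hr2⟩ := EReal.lt_iff_exists_real_btwn.1 ha
  rw [EReal.coe_lt_coe_iff] at hr1
  rw [Metric.tendsto_nhds]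
  intro δ hδ
  have hε : 0 < min (r - L a) δ := lt_min (sub_pos.2 hr1) hδ
  have hε1 := min_le_left (r - L a) δ
  have hε2 := min_le_right (r - L a) δ
  filter_upwards [hγ.tendsto.eventually (hL _ hε), hγ.tendsto.eventually (hl.ae_eq hM),
    hγ.eventually_bestUtility_eq hM hl hr2] with k ⟨h1, h2⟩ h3 h4
  obtain ⟨x, ⟨hx1, hx2⟩, hx3⟩ := (h1.and_eventually (h3 M.target)).exists
  obtain ⟨x', ⟨hx1', hx2'⟩, hx3'⟩ := (h2.and_eventually (h3 M.target)).exists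
  rw [h4 _ (by linarith [(abs_lt.1 (hx1 a)).2])] at hx3
  rw [h4 _ (by linarith [(abs_lt.1 (hx1' a)).2])] at hx3'
  rw [Real.dist_eq, abs_lt]
  constructor <;> linarith

variable {w : ∀ n, (Fin n → X) → ℝ}

/-- A cheaper deviation is punished with nonvanishing probability, hence at its mean score. -/
theorem exists_meanScore_le (hM : M.Assumptions) (hl : M.AreMultipliers w l)
    (hγ : M.IsThreshold l φ γ) {a : M.Deviation} (ha : M.c a < M.c M.target) :
    ∃ a', (M.meanScore a a' : EReal) ≤ γ a' := by
  have := Fintype.ofFinite M.Deviation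
  by_contra! hcon
  obtain ⟨η, hη, hlow⟩ := hγ.eventually_le_bestUtility hM hl hcon
  set c := M.c M.target with hc
  -- If the mean score were in the open reward region, `a` would be paid about `c(a*)`. Incentive
  -- compatibility allows at most `c(a) + δ`, which is below `c(a*) - δ`.
  set δ := (c - M.c a) / 4 with hδ
  have hδ0 : 0 < δ := by linarith
  set b := M.u M.wmin with hb
  set B : ∀ n, Set (Fin n → X) := fun n => {x | ∃ a', η ≤ |M.score n x a' - M.meanScore a a'|}
    with hB
  have hBm : ∀ n, MeasurableSet (B n) := fun n => by
    simp only [hB, ofPred_exists]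
    exact MeasurableSet.iUnion fun a' => measurableSet_le measurable_const
      ((M.measurable_score_apply n a').sub_const _).abs
  have hPB : Tendsto (fun n => (M.law n a).real (B n)) atTop (𝓝 0) :=
    hM.tendsto_law_exists_score a hη
  have hlim : Tendsto (fun n => (c - δ) - (c - δ - b) * (M.law n a).real (B n)) atTop
      (𝓝 (c - δ)) := by simpa using (hPB.const_mul (c - δ - b)).const_sub (c - δ)
  have hev := hlim.eventually_const_lt (show M.c a + δ < c - δ by linarith)
  obtain ⟨k, h1, h2, h3, h4, h5⟩ := ((hlow (c - δ) (by linarith)).and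
    ((hγ.tendsto.eventually (hl.ae_eq hM)).and ((hγ.tendsto.eventually hl).and
    ((hγ.tendsto.eventually (hl.eventually_integral_le hM
      (show c < c + δ by linarith))).and (hγ.tendsto.eventually hev))))).exists
  have := hM.isProbabilityMeasure_law (φ k) a
  have hge : ∀ᵐ x ∂(M.law (φ k) a), (c - δ) - (B (φ k)).indicator (fun _ => c - δ - b) x ≤
      w (φ k) x := by
    filter_upwards [h2 a] with x hx
    by_cases hxB : x ∈ B (φ k)
    · rw [indicator_of_mem hxB, sub_sub_cancel]
      exact hM.u_wmin_le (h3.1.1.range x)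
    · rw [indicator_of_notMem hxB, sub_zero, hx]
      refine h1 _ fun a' => ?_
      simp only [hB, mem_ofPred_eq, not_exists, not_le] at hxB
      exact hxB a'
  have h6 := integral_mono_ae ((integrable_const _).sub ((integrable_const _).indicator
    (hBm (φ k)))) (h3.1.1.integrable a) hge
  rw [integral_sub' (integrable_const _) ((integrable_const _).indicator (hBm (φ k))),
    integral_indicator_const _ (hBm (φ k))] at h6
  simp only [integral_const, probReal_univ, smul_eq_mul, one_mul] at h6
  have h7 := h3.1.1.ic a
  have h8 := h4 M.target
  rw [mul_comm] at h6
  linarith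

/-- The large deviation cost of the punishment region: a law of signals whose mean score lies in
the interior of the region has relative entropy at least `k`. -/
theorem le_integral_of_mean_lt (hM : M.Assumptions) (hl : M.AreMultipliers w l)
    (hγ : M.IsThreshold l φ γ) {k : ℝ} (hk0 : 0 < k)
    (hk : ∀ a : M.Deviation, M.c a < M.c M.target → k ≤ -M.meanScore a a)
    {ν : Measure X} [IsProbabilityMeasure ν] {F : X → ℝ} (hF : Measurable F)
    (hν : ν = (M.μ M.target).withDensity fun x => ENNReal.ofReal (Real.exp (F x)))
    (hF2 : MemLp F 2 ν) {a : M.Deviation} (ha2 : MemLp (fun x => M.logRatio x a) 2 ν)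
    (ha : ((∫ x, M.logRatio x a ∂ν : ℝ) : EReal) < γ a) : k ≤ ∫ x, F x ∂ν := by
  have := Fintype.ofFinite M.Deviation
  have := hM.isProbabilityMeasure
  by_contra! hlt
  obtain ⟨r, hr1, hr2⟩ := EReal.lt_iff_exists_real_btwn.1 ha
  rw [EReal.coe_lt_coe_iff] at hr1
  set m := ∫ x, M.logRatio x a ∂ν with hm
  set K := ∫ x, F x ∂ν with hK
  -- Since `4 η ≤ k - K`, the exponents combine to `(K + η) - (k - η) ≤ -2 η ≤ -η`.
  set η := min (k / 2) ((k - K) / 4) with hη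
  have hη0 : 0 < η := lt_min (by linarith) (by linarith)
  have hη1 : η ≤ k / 2 := min_le_left _ _
  have hη2 : η ≤ (k - K) / 4 := min_le_right _ _
  obtain ⟨C, hC⟩ := hM.exists_law_le hk hη0 (by linarith) u_wmin_mem (hM.u_wmin_lt_c M.target)
  have hlln1 := tendsto_pi_abs_sub_ge hF2 hη0
  have hlln2 := tendsto_pi_abs_sub_ge ha2 (sub_pos.2 hr1)
  have hsum : ∀ᶠ n : ℕ in atTop, (Measure.pi fun _ : Fin n => ν).real
      {x | η ≤ |(1 / (n : ℝ)) * ∑ i, F (x i) - K|} +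
      (Measure.pi fun _ : Fin n => ν).real
      {x | r - m ≤ |(1 / (n : ℝ)) * ∑ i, M.logRatio (x i) a - m|} < 1 / 2 :=
    (hlln1.add hlln2).eventually_lt_const (show (0 : ℝ) + 0 < 1 / 2 by norm_num)
  have hsmall := (tendsto_const_mul_exp_neg_nat_mul C hη0).eventually_lt_const
    (show (0 : ℝ) < 1 / 2 by norm_num)
  have hN := hC.and (hsum.and (hsmall.and (hl.and ((hl.ae_eq hM).and (eventually_gt_atTop 0)))))
  obtain ⟨j, ⟨h1, h2, h3, h5, h6, h7⟩, h4⟩ := ((hγ.tendsto.eventually hN).and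
    (hγ.eventually_bestUtility_eq hM hl hr2)).exists
  generalize φ j = n at *
  have hn0 : (0 : ℝ) < n := by exact_mod_cast h7
  -- On `E` the score is punished and the density relative to the target is typical for `ν`. Its
  -- `ν`-probability exceeds one half, yet the change of measure bounds it by `C * exp (-n η)`.
  set E : Set (Fin n → X) := {x | M.score n x a ≤ r} ∩ {x | ∑ i, F (x i) ≤ n * (K + η)} with hE
  have hFm : Measurable fun x : Fin n → X => ∑ i, F (x i) :=
    Finset.measurable_sum _ fun i _ => hF.comp (measurable_pi_apply i)
  have hEm : MeasurableSet E :=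
    (measurableSet_le (M.measurable_score_apply n a) measurable_const).inter
      (measurableSet_le hFm measurable_const)
  have hEc : (Measure.pi fun _ : Fin n => ν).real Eᶜ < 1 / 2 := by
    refine lt_of_le_of_lt (le_trans (measureReal_mono ?_) (measureReal_union_le _ _)) h2
    intro x hx
    simp only [hE, compl_inter, mem_union, mem_compl_iff, mem_ofPred_eq, not_le] at hx ⊢
    rcases hx with hx | hx
    · right
      refine le_trans ?_ (le_abs_self _)
      simp only [score] at hx
      linarith
    · left
      refine le_trans ?_ (le_abs_self _)
      have : K + η ≤ (1 / (n : ℝ)) * ∑ i, F (x i) := by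
        rw [one_div, le_inv_mul_iff₀ hn0]
        exact hx.le
      linarith
  have hE1 := probReal_compl_eq_one_sub (μ := Measure.pi fun _ : Fin n => ν) hEm
  have hE2 := pi_le_exp_mul_pi hF hν hEm (s := n * (K + η)) fun x hx => hx.2
  have hE3 : (M.law n M.target).real E ≤
      (M.law n M.target).real {x | w n x ≤ M.u M.wmin} := by
    have := hM.isProbabilityMeasure_law n M.target
    refine ENNReal.toReal_mono (by finiteness) (measure_mono_ae ?_)
    filter_upwards [h6 M.target] with x hx hxE
    change w n x ≤ M.u M.wmin
    rw [hx, h4 _ hxE.1]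
  have hE4 := h1 (w n) h5.1
  have hE5 : (Measure.pi fun _ : Fin n => ν).real E ≤
      Real.exp (n * (K + η)) * (C * Real.exp (-(n * (k - η)))) :=
    hE2.trans (mul_le_mul_of_nonneg_left (hE3.trans hE4) (Real.exp_pos _).le)
  have hC0 : 0 ≤ C := by
    have := measureReal_nonneg.trans hE4
    exact nonneg_of_mul_nonneg_left this (Real.exp_pos _)
  have hE6 : Real.exp (n * (K + η)) * (C * Real.exp (-(n * (k - η)))) ≤
      C * Real.exp (-(n * η)) := by
    rw [mul_left_comm, ← Real.exp_add]
    refine mul_le_mul_of_nonneg_left (Real.exp_le_exp.2 ?_) hC0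
    nlinarith
  linarith

/-- Reweighting the signals of the cheapest-to-detect deviation `a` so that `a` becomes harder to
tell from the target action moves the mean score out of the punishment region. -/
theorem not_eventually_perturbation_lt (hM : M.Assumptions) (hl : M.AreMultipliers w l)
    (hγ : M.IsThreshold l φ γ) {a : M.Deviation}
    (hk : ∀ b : M.Deviation, M.c b < M.c M.target → -M.meanScore a a ≤ -M.meanScore b b)
    {g : X → ℝ} (hg : Measurable g) {B : ℝ} (hgB : ∀ x, |g x| ≤ B)
    (hg0 : ∫ x, g x ∂(M.μ a) = 0) (hga : 0 < ∫ x, g x * M.logRatio x a ∂(M.μ a))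
    (a' : M.Deviation) : ¬ ∀ᶠ t : ℝ in 𝓝[>] 0,
      ((M.meanScore a a' + t * ∫ x, g x * M.logRatio x a' ∂(M.μ a) : ℝ) : EReal) < γ a' := by
  have := hM.isProbabilityMeasure
  intro hev
  set c₁ := ∫ x, g x * M.logRatio x a ∂(M.μ a) with hc₁
  have hB0 : 0 ≤ B := by
    obtain ⟨x⟩ := nonempty_of_isProbabilityMeasure (M.μ a)
    exact (abs_nonneg _).trans (hgB x)
  have hpos : ∀ᶠ t : ℝ in 𝓝[>] 0, 0 < t := eventually_mem_nhdsWithin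
  have hlt : ∀ᶠ t : ℝ in 𝓝[>] 0, t * (B + 1) < 1 / 2 ∧ t * B ^ 2 < c₁ := by
    refine Filter.Eventually.filter_mono nhdsWithin_le_nhds (Eventually.and ?_ ?_)
    · have : Tendsto (fun t : ℝ => t * (B + 1)) (𝓝 0) (𝓝 0) := by
        simpa using (tendsto_id (α := ℝ) (x := 𝓝 0)).mul_const (B + 1)
      exact this.eventually_lt_const (by norm_num)
    · have : Tendsto (fun t : ℝ => t * B ^ 2) (𝓝 0) (𝓝 0) := by
        simpa using (tendsto_id (α := ℝ) (x := 𝓝 0)).mul_const (B ^ 2)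
      exact this.eventually_lt_const hga
  -- The first bound keeps `1 + t g` between `1/2` and `3/2`; the second makes the linear gain `t
  -- c₁` in divergence outweigh the quadratic error `t² B²`.
  obtain ⟨t, ht, ht0, ht1, ht2⟩ := (hev.and (hpos.and hlt)).exists
  have htg : ∀ x, |t * g x| ≤ 1 / 2 := fun x => by
    rw [abs_mul, abs_of_pos ht0]
    nlinarith [hgB x]
  have hd : ∀ x, 0 < 1 + t * g x := fun x => by linarith [(abs_le.1 (htg x)).1]
  have hdm : Measurable fun x => 1 + t * g x := (hg.const_mul t).const_add 1
  have hgi : Integrable g (M.μ a) := Integrable.of_mem_Icc (-B) B hg.aemeasurable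
    (ae_of_all _ fun x => abs_le.1 (hgB x))
  have hgl : ∀ b, Integrable (fun x => g x * M.logRatio x b) (M.μ a) := fun b =>
    (hM.integrable_logRatio b a).bdd_mul hg.aestronglyMeasurable
      (ae_of_all _ fun x => by rw [Real.norm_eq_abs]; exact hgB x)
  set ν := (M.μ a).withDensity fun x => ENNReal.ofReal (1 + t * g x) with hν
  have hνi : ∀ f : X → ℝ, ∫ x, f x ∂ν = ∫ x, (1 + t * g x) * f x ∂(M.μ a) := fun f => by
    rw [hν, integral_withDensity_eq_integral_toReal_smul hdm.ennreal_ofReal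
      (ae_of_all _ fun _ => ENNReal.ofReal_lt_top)]
    refine integral_congr_ae (ae_of_all _ fun x => ?_)
    simp [ENNReal.toReal_ofReal (hd x).le]
  have hdi : Integrable (fun x => 1 + t * g x) (M.μ a) :=
    (integrable_const 1).add (hgi.const_mul t)
  have hνp : IsProbabilityMeasure ν := by
    refine ⟨?_⟩
    rw [hν, withDensity_apply _ MeasurableSet.univ, Measure.restrict_univ,
      ← ofReal_integral_eq_lintegral_ofReal hdi
        (ae_of_all _ fun x => (hd x).le),
      integral_add (integrable_const 1) (hgi.const_mul t), integral_const_mul, hg0]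
    simp
  have hνle : ν ≤ (2 : ENNReal) • M.μ a := by
    rw [hν, ← withDensity_const]
    refine withDensity_mono (ae_of_all _ fun x => ?_)
    rw [← ENNReal.ofReal_ofNat]
    exact ENNReal.ofReal_le_ofReal (by linarith [(abs_le.1 (htg x)).2])
  have hL2 : ∀ b, MemLp (fun x => M.logRatio x b) 2 ν := fun b =>
    (hM.memLp_logRatio b a).of_measure_le_smul (by finiteness) hνle
  have hlogm : Measurable fun x => Real.log (1 + t * g x) := Real.measurable_log.comp hdm
  have hlogbd : ∀ x, ‖Real.log (1 + t * g x)‖ ≤ Real.log 2 := fun x => by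
    have h1 := (abs_le.1 (htg x))
    rw [Real.norm_eq_abs, abs_le]
    constructor
    · rw [← Real.log_inv]
      exact Real.log_le_log (by norm_num) (by linarith)
    · exact Real.log_le_log (hd x) (by linarith)
  have hlogb : MemLp (fun x => Real.log (1 + t * g x)) 2 ν :=
    MemLp.of_bound hlogm.aestronglyMeasurable (Real.log 2) (ae_of_all _ hlogbd)
  set F : X → ℝ := fun x => Real.log (1 + t * g x) - M.logRatio x a with hF
  have hFm : Measurable F := hlogm.sub (M.measurable_logRatio_apply a)
  have hνF : ν = (M.μ M.target).withDensity fun x => ENNReal.ofReal (Real.exp (F x)) := by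
    have hm : Measurable fun x => ENNReal.ofReal (Real.exp (-M.logRatio x a)) :=
      (M.measurable_logRatio_apply a).neg.exp.ennreal_ofReal
    rw [hν, hM.eq_withDensity_target a, ← withDensity_mul _ hm hdm.ennreal_ofReal]
    congr 1
    ext x
    simp only [hF]
    rw [Pi.mul_apply, ← ENNReal.ofReal_mul (Real.exp_pos _).le, sub_eq_add_neg, Real.exp_add,
      Real.exp_log (hd x), mul_comm]
  have hmean : ∫ x, M.logRatio x a' ∂ν =
      M.meanScore a a' + t * ∫ x, g x * M.logRatio x a' ∂(M.μ a) := by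
    rw [hνi, meanScore, ← integral_const_mul,
      ← integral_add (hM.integrable_logRatio a' a) ((hgl a').const_mul t)]
    exact integral_congr_ae (ae_of_all _ fun x => by ring)
  have hrate := hγ.le_integral_of_mean_lt hM hl (neg_pos.2 (hM.klDiv_deviation a).1) hk hFm hνF
    (hlogb.sub (hL2 a)) (hL2 a') (by rwa [hmean])
  have hFi : Integrable F (M.μ a) :=
    (Integrable.of_bound hlogm.aestronglyMeasurable (Real.log 2) (ae_of_all _ hlogbd)).sub
      (hM.integrable_logRatio a a)
  have hi1 : Integrable (fun x => t * g x + (t * B) ^ 2) (M.μ a) :=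
    (hgi.const_mul t).add (integrable_const _)
  have hi2 : Integrable (fun x => M.logRatio x a + t * (g x * M.logRatio x a)) (M.μ a) :=
    (hM.integrable_logRatio a a).add ((hgl a).const_mul t)
  -- From `(1 + s) log (1 + s) ≤ s + s²`: the divergence of `ν` is at most `-E_a[L(a)] - t c₁ + t²
  -- B²`, contradicting `hrate`.
  have hupper : ∫ x, F x ∂ν ≤ ∫ x, ((t * g x + (t * B) ^ 2) -
      (M.logRatio x a + t * (g x * M.logRatio x a))) ∂(M.μ a) := by
    rw [hνi]
    refine integral_mono (hFi.bdd_mul (c := 2) hdm.aestronglyMeasurable (ae_of_all _ fun x => ?_))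
      (hi1.sub hi2) fun x => ?_
    · rw [Real.norm_of_nonneg (hd x).le]
      linarith [(abs_le.1 (htg x)).2]
    · have h1 := Real.log_le_sub_one_of_pos (hd x)
      have h2 := mul_le_mul_of_nonneg_left h1 (hd x).le
      have h3 : (t * g x) ^ 2 ≤ (t * B) ^ 2 := by
        rw [mul_pow, mul_pow]
        exact mul_le_mul_of_nonneg_left (sq_le_sq' (by linarith [(abs_le.1 (hgB x)).1])
          (abs_le.1 (hgB x)).2) (sq_nonneg t)
      simp only [hF]
      nlinarith
  rw [integral_sub hi1 hi2, integral_add (hgi.const_mul t) (integrable_const _),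
    integral_add (hM.integrable_logRatio a a) ((hgl a).const_mul t), integral_const_mul,
    integral_const_mul, hg0] at hupper
  simp only [integral_const, probReal_univ, smul_eq_mul, one_mul, mul_zero, zero_add] at hupper
  change _ ≤ _ - (M.meanScore a a + t * c₁) at hupper
  nlinarith

end IsThreshold

end Asymptotics

end MoralHazard

namespace MoralHazard

/-! ### Geometry of the score domain and leniency of the threshold. -/

section ScoreDomain

variable {A X : Type*} [MeasurableSpace X] {M : MoralHazard A X}

theorem convex_scoreDomain (M : MoralHazard A X) : Convex ℝ M.scoreDomain :=
  (convex_convexHull ℝ _).closure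

theorem isClosed_scoreDomain (M : MoralHazard A X) : IsClosed M.scoreDomain := isClosed_closure

theorem Assumptions.ae_mem_scoreDomain [Finite A] (hM : M.Assumptions) (b : A) :
    ∀ᵐ x ∂(M.μ b), M.logRatio x ∈ M.scoreDomain := by
  refine (hM.absolutelyContinuous M.target b).ae_le ?_
  have h : ∀ᵐ L ∂((M.μ M.target).map M.logRatio),
      L ∈ ((M.μ M.target).map M.logRatio).support := Measure.support_mem_ae
  filter_upwards [ae_of_ae_map M.measurable_logRatio.aemeasurable h] with x hx
  exact subset_closure (subset_convexHull ℝ _ hx)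

theorem Assumptions.meanScore_mem [Finite A] (hM : M.Assumptions) (b : A) :
    M.meanScore b ∈ M.scoreDomain := by
  have := Fintype.ofFinite M.Deviation
  have := hM.isProbabilityMeasure
  have hi : ∀ a, Integrable (fun x => M.logRatio x a) (M.μ b) :=
    fun a => hM.integrable_logRatio a b
  have h := M.convex_scoreDomain.integral_mem M.isClosed_scoreDomain (hM.ae_mem_scoreDomain b)
    (Integrable.of_eval hi)
  have e : ∫ x, M.logRatio x ∂(M.μ b) = M.meanScore b := by
    ext a
    exact eval_integral hi a
  rwa [e] at h

/-- A constant likelihood ratio between probability measures must be one, contradicting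
identification. -/
theorem Assumptions.not_ae_eq_meanScore (hM : M.Assumptions) (a : M.Deviation) (b : A) :
    ¬ ∀ᵐ x ∂(M.μ b), M.logRatio x a = M.meanScore b a := by
  intro h
  have := hM.isProbabilityMeasure
  have h1 := hM.target_eq_withDensity a
  have h2 : (fun x => ENNReal.ofReal (Real.exp (M.logRatio x a))) =ᵐ[M.μ a]
      fun _ => ENNReal.ofReal (Real.exp (M.meanScore b a)) :=
    Filter.Eventually.mono ((hM.absolutelyContinuous b a).ae_le h) fun x hx => by simp only [hx]
  rw [withDensity_congr_ae h2, withDensity_const] at h1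
  have h3 := congrArg (fun μ => μ univ) h1
  simp only [measure_univ, Measure.smul_apply, smul_eq_mul, mul_one] at h3
  rw [← h3, one_smul] at h1
  exact hM.identified _ _ a.2 h1.symm

theorem Assumptions.exists_mem_scoreDomain_lt [Finite A] (hM : M.Assumptions) (a : M.Deviation)
    (b : A) : ∃ z ∈ M.scoreDomain, z a < M.meanScore b a := by
  by_contra! hcon
  have := hM.isProbabilityMeasure
  refine hM.not_ae_eq_meanScore a b ?_
  have hle : ∀ᵐ x ∂(M.μ b), M.meanScore b a ≤ M.logRatio x a :=
    (hM.ae_mem_scoreDomain b).mono fun x hx => hcon _ hx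
  have h := (integral_eq_iff_of_ae_le (integrable_const _) (hM.integrable_logRatio a b) hle).1
    (by simp [meanScore])
  exact h.mono fun x hx => hx.symm

theorem Assumptions.exists_mem_scoreDomain_gt [Finite A] (hM : M.Assumptions) (a : M.Deviation)
    (b : A) : ∃ z ∈ M.scoreDomain, M.meanScore b a < z a := by
  by_contra! hcon
  have := hM.isProbabilityMeasure
  refine hM.not_ae_eq_meanScore a b ?_
  have hle : ∀ᵐ x ∂(M.μ b), M.logRatio x a ≤ M.meanScore b a :=
    (hM.ae_mem_scoreDomain b).mono fun x hx => hcon _ hx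
  exact (integral_eq_iff_of_ae_le (hM.integrable_logRatio a b) (integrable_const _) hle).1
    (by simp [meanScore])

/-- The mean scores under bounded reweightings of the law of signals under `b`. -/
def reweightedScores (M : MoralHazard A X) (b : A) : Set M.Score :=
  {y | ∃ g : X → ℝ, Measurable g ∧ (∃ B, ∀ x, |g x| ≤ B) ∧ (∀ x, 0 ≤ g x) ∧
    ∫ x, g x ∂(M.μ b) = 1 ∧ ∀ a, ∫ x, g x * M.logRatio x a ∂(M.μ b) = y a}

theorem Assumptions.integrable_of_abs_le (hM : M.Assumptions) (b : A) {g : X → ℝ}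
    (hg : Measurable g) {B : ℝ} (hB : ∀ x, |g x| ≤ B) : Integrable g (M.μ b) := by
  have := hM.isProbabilityMeasure
  exact Integrable.of_bound hg.aestronglyMeasurable B (ae_of_all _ hB)

theorem Assumptions.integrable_mul_logRatio (hM : M.Assumptions) (a : M.Deviation) (b : A)
    {g : X → ℝ} (hg : Measurable g) {B : ℝ} (hB : ∀ x, |g x| ≤ B) :
    Integrable (fun x => g x * M.logRatio x a) (M.μ b) :=
  (hM.integrable_logRatio a b).bdd_mul hg.aestronglyMeasurable (ae_of_all _ hB)

theorem Assumptions.convex_reweightedScores (hM : M.Assumptions) (b : A) :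
    Convex ℝ (M.reweightedScores b) := by
  rintro y ⟨g, hg, ⟨B, hB⟩, hg0, hg1, hgy⟩ y' ⟨g', hg', ⟨B', hB'⟩, hg0', hg1', hgy'⟩ s t hs ht hst
  refine ⟨fun x => s * g x + t * g' x, (hg.const_mul s).add (hg'.const_mul t),
    ⟨s * B + t * B', fun x => ?_⟩, fun x => add_nonneg (mul_nonneg hs (hg0 x))
      (mul_nonneg ht (hg0' x)), ?_, fun a => ?_⟩
  · refine (abs_add_le _ _).trans (add_le_add ?_ ?_)
    · rw [abs_mul, abs_of_nonneg hs]
      exact mul_le_mul_of_nonneg_left (hB x) hs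
    · rw [abs_mul, abs_of_nonneg ht]
      exact mul_le_mul_of_nonneg_left (hB' x) ht
  · rw [integral_add ((hM.integrable_of_abs_le b hg hB).const_mul s)
      ((hM.integrable_of_abs_le b hg' hB').const_mul t), integral_const_mul, integral_const_mul,
      hg1, hg1', mul_one, mul_one, hst]
  · simp only [add_mul, mul_assoc]
    rw [integral_add ((hM.integrable_mul_logRatio a b hg hB).const_mul s)
      ((hM.integrable_mul_logRatio a b hg' hB').const_mul t), integral_const_mul,
      integral_const_mul, hgy, hgy']
    simp

/-- Conditioning `μ b` on a small ball around a support point gives a mean score near that point;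
convexity of the reweighted scores does the rest. -/
theorem Assumptions.scoreDomain_subset_closure [Finite A] (hM : M.Assumptions) (b : A) :
    M.scoreDomain ⊆ closure (M.reweightedScores b) := by
  have := Fintype.ofFinite M.Deviation
  have := hM.isProbabilityMeasure
  refine closure_minimal (convexHull_min ?_ (hM.convex_reweightedScores b).closure)
    isClosed_closure
  intro y hy
  rw [Metric.mem_closure_iff]
  intro ε hε
  set S := M.logRatio ⁻¹' Metric.ball y (ε / 2) with hS
  have hSm : MeasurableSet S := M.measurable_logRatio Metric.isOpen_ball.measurableSet
  have hS0 : M.μ b S ≠ 0 := by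
    intro h0
    have h1 := (Measure.mem_support_iff_forall y).1 hy _
      (Metric.ball_mem_nhds y (half_pos hε))
    rw [Measure.map_apply M.measurable_logRatio Metric.isOpen_ball.measurableSet] at h1
    exact h1.ne' (hM.absolutelyContinuous b M.target h0)
  set p := (M.μ b).real S with hp
  have hp0 : 0 < p := ENNReal.toReal_pos hS0 (by finiteness)
  set g : X → ℝ := S.indicator fun _ => p⁻¹ with hg
  have hgm : Measurable g := measurable_const.indicator hSm
  have hgn : ∀ x, 0 ≤ g x := indicator_nonneg fun _ _ => (inv_pos.2 hp0).le
  have hgB : ∀ x, |g x| ≤ p⁻¹ := fun x => by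
    rw [abs_of_nonneg (hgn x)]
    exact indicator_le_self' (fun _ _ => (inv_pos.2 hp0).le) x
  have hg1 : ∫ x, g x ∂(M.μ b) = 1 := by
    rw [hg, integral_indicator_const _ hSm, smul_eq_mul, ← hp, mul_inv_cancel₀ hp0.ne']
  refine ⟨fun a => ∫ x, g x * M.logRatio x a ∂(M.μ b),
    ⟨g, hgm, ⟨p⁻¹, hgB⟩, hgn, hg1, fun a => rfl⟩, ?_⟩
  have hgi := hM.integrable_of_abs_le b hgm hgB
  rw [dist_comm]
  refine lt_of_le_of_lt ((dist_pi_le_iff (half_pos hε).le).2 fun a => ?_) (half_lt_self hε)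
  have e : ∫ x, g x * M.logRatio x a ∂(M.μ b) - y a =
      ∫ x, (g x * M.logRatio x a - g x * y a) ∂(M.μ b) := by
    rw [integral_sub (hM.integrable_mul_logRatio a b hgm hgB) (hgi.mul_const _),
      integral_mul_const, hg1, one_mul]
  rw [Real.dist_eq, e]
  refine (norm_integral_le_of_norm_le (f := fun x => g x * M.logRatio x a - g x * y a)
    (hgi.mul_const (ε / 2)) (ae_of_all _ fun x => ?_)).trans_eq ?_
  · by_cases hx : x ∈ S
    · have h1 : |M.logRatio x a - y a| ≤ ε / 2 := by
        rw [← Real.dist_eq]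
        exact (dist_le_pi_dist _ _ a).trans (Metric.mem_ball.1 hx).le
      rw [← mul_sub, norm_mul, Real.norm_of_nonneg (hgn x)]
      exact mul_le_mul_of_nonneg_left h1 (hgn x)
    · simp [hg, hx]
  · rw [integral_mul_const, hg1, one_mul]

/-- The open punishment region cannot contain the mean score of the cheapest-to-detect
deviation `a` in its own coordinate. -/
theorem IsThreshold.le_meanScore [Fintype A] {w : ∀ n, (Fin n → X) → ℝ} {l : ℕ → A → ℝ}
    {φ : ℕ → ℕ} {γ : M.Deviation → EReal} (hM : M.Assumptions) (hl : M.AreMultipliers w l)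
    (hγ : M.IsThreshold l φ γ) {a : M.Deviation}
    (hk : ∀ b : M.Deviation, M.c b < M.c M.target → -M.meanScore a a ≤ -M.meanScore b b) :
    γ a ≤ M.meanScore a a := by
  have := hM.isProbabilityMeasure
  by_contra! hlt
  obtain ⟨z, hz, hza⟩ := hM.exists_mem_scoreDomain_lt a a
  obtain ⟨y, hya, g, hg, ⟨B, hB⟩, -, hg1, hgy⟩ := mem_closure_iff.1
    (hM.scoreDomain_subset_closure (a : A) hz) {y | y a < M.meanScore a a}
    (isOpen_lt (continuous_apply a) continuous_const) hza
  rw [mem_ofPred_eq] at hya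
  have hgl : ∀ a', ∫ x, (1 - g x) * M.logRatio x a' ∂(M.μ a) = M.meanScore a a' - y a' := by
    intro a'
    simp only [sub_mul, one_mul]
    rw [integral_sub (hM.integrable_logRatio a' a) (hM.integrable_mul_logRatio a' a hg hB), hgy]
    rfl
  -- The direction `1 - g` moves the mean score away from `y`, hence raises coordinate `a` and
  -- lowers the divergence, while small steps stay below `γ a`.
  refine hγ.not_eventually_perturbation_lt hM hl hk (hg.const_sub 1) (B := 1 + B)
    (fun x => ?_) ?_ ?_ a ?_
  · refine (abs_sub _ _).trans ?_
    rw [abs_one]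
    linarith [hB x]
  · rw [integral_sub (integrable_const _) (hM.integrable_of_abs_le a hg hB), hg1]
    simp
  · rw [hgl]
    linarith
  · have hc : Tendsto (fun t : ℝ => ((M.meanScore a a + t *
        ∫ x, (1 - g x) * M.logRatio x a ∂(M.μ a) : ℝ) : EReal)) (𝓝[>] 0)
        (𝓝 (M.meanScore a a)) := by
      refine (continuous_coe_real_ereal.tendsto _).comp (Tendsto.mono_left ?_ nhdsWithin_le_nhds)
      have : Continuous fun t : ℝ => M.meanScore a a + t *
        ∫ x, (1 - g x) * M.logRatio x a ∂(M.μ a) := by fun_prop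
      simpa using this.tendsto 0
    exact hc.eventually_lt_const hlt

/-- Scores that are worse news about the cheapest-to-detect deviation `a` than its mean score are
punished. -/
theorem IsThreshold.lt_of_lt_meanScore [Fintype A] {w : ∀ n, (Fin n → X) → ℝ} {l : ℕ → A → ℝ}
    {φ : ℕ → ℕ} {γ : M.Deviation → EReal} (hM : M.Assumptions) (hl : M.AreMultipliers w l)
    (hγ : M.IsThreshold l φ γ) {a : M.Deviation}
    (hk : ∀ b : M.Deviation, M.c b < M.c M.target → -M.meanScore a a ≤ -M.meanScore b b)
    {a' : M.Deviation} (ha' : (M.meanScore a a' : EReal) ≤ γ a') {L : M.Score}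
    (hL : L ∈ M.scoreDomain) (hLa : L a < M.meanScore a a) : (L a' : EReal) < γ a' := by
  have := hM.isProbabilityMeasure
  refine lt_of_lt_of_le ?_ ha'
  rw [EReal.coe_lt_coe_iff]
  by_contra! hcon
  -- `L a'` may equal the mean score; a small step towards `z` makes the inequality in coordinate
  -- `a'` strict and preserves the one in coordinate `a`.
  obtain ⟨z, hz, hza⟩ := hM.exists_mem_scoreDomain_gt a' a
  obtain ⟨t, ht0, ht1, hta⟩ : ∃ t : ℝ, 0 < t ∧ t ≤ 1 ∧ (1 - t) * L a + t * z a < M.meanScore a a := by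
    have hc : Tendsto (fun t : ℝ => (1 - t) * L a + t * z a) (𝓝[>] 0) (𝓝 (L a)) := by
      refine Tendsto.mono_left ?_ nhdsWithin_le_nhds
      have : Continuous fun t : ℝ => (1 - t) * L a + t * z a := by fun_prop
      simpa using this.tendsto 0
    obtain ⟨t, h1, h2⟩ := ((hc.eventually_lt_const hLa).and
      (Ioc_mem_nhdsGT (zero_lt_one' ℝ))).exists
    exact ⟨t, h2.1, h2.2, h1⟩
  have hmem := M.convex_scoreDomain hL hz (sub_nonneg.2 ht1) ht0.le (by ring)
  obtain ⟨y, hya, g, hg, ⟨B, hB⟩, -, hg1, hgy⟩ := mem_closure_iff.1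
    (hM.scoreDomain_subset_closure (a : A) hmem)
    ({y | y a < M.meanScore a a} ∩ {y | M.meanScore a a' < y a'})
    ((isOpen_lt (continuous_apply a) continuous_const).inter
      (isOpen_lt continuous_const (continuous_apply a'))) (by
      refine ⟨by simpa using hta, ?_⟩
      simp only [mem_ofPred_eq, Pi.add_apply, Pi.smul_apply, smul_eq_mul]
      nlinarith)
  rw [mem_inter_iff, mem_ofPred_eq, mem_ofPred_eq] at hya
  have hgl : ∀ a', ∫ x, (1 - g x) * M.logRatio x a' ∂(M.μ a) = M.meanScore a a' - y a' := by
    intro a'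
    simp only [sub_mul, one_mul]
    rw [integral_sub (hM.integrable_logRatio a' a) (hM.integrable_mul_logRatio a' a hg hB), hgy]
    rfl
  -- Moving away from `y` raises coordinate `a` and lowers coordinate `a'` below the mean score,
  -- thus strictly below `γ a'`.
  refine hγ.not_eventually_perturbation_lt hM hl hk (hg.const_sub 1) (B := 1 + B)
    (fun x => ?_) ?_ ?_ a' ?_
  · refine (abs_sub _ _).trans ?_
    rw [abs_one]
    linarith [hB x]
  · rw [integral_sub (integrable_const _) (hM.integrable_of_abs_le a hg hB), hg1]
    simp
  · rw [hgl]
    linarith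
  · filter_upwards [self_mem_nhdsWithin] with t ht
    refine lt_of_lt_of_le ?_ ha'
    rw [EReal.coe_lt_coe_iff, hgl]
    have : t * (M.meanScore a a' - y a') < 0 :=
      mul_neg_of_pos_of_neg ht (by linarith)
    linarith

end ScoreDomain

end MoralHazard

/-! ### Identifying a weak limit from pointwise limits of subsequences. -/

section WeakLimit

variable {S : Type*} [MeasurableSpace S]

theorem WeaklyConvergesL2.neg {ρ : Measure S} {v : ℕ → S → ℝ} {V : S → ℝ}
    (h : WeaklyConvergesL2 ρ v V) : WeaklyConvergesL2 ρ (fun n s => -v n s) fun s => -V s := by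
  refine ⟨h.1.mono fun n hn => hn.neg, h.2.1.neg, fun g hg => ?_⟩
  simpa only [neg_mul, integral_neg] using (h.2.2 g hg).neg

/-- Countably many finite-measure sets, on each of which the bound `C + 1 / (j + 1)` holds from a
fixed index on, exhaust `R` up to a null set; indicators of their subsets are test functions. -/
theorem WeaklyConvergesL2.ae_le_of_tendsto {ρ : Measure S} [SigmaFinite ρ] {v : ℕ → S → ℝ}
    {V : S → ℝ} (h : WeaklyConvergesL2 ρ v V) {φ : ℕ → ℕ} (hφ : Tendsto φ atTop atTop)
    {R : Set S} (hR : MeasurableSet R) {C : ℝ}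
    (hlim : ∀ᵐ s ∂ρ, s ∈ R → Tendsto (fun k => v (φ k) s) atTop (𝓝 C)) :
    ∀ᵐ s ∂ρ, s ∈ R → V s ≤ C := by
  obtain ⟨N₀, hN₀⟩ := eventually_atTop.1 (hφ.eventually h.1)
  suffices hε : ∀ j : ℕ, ∀ N : ℕ, ∀ i : ℕ, ∀ᵐ s ∂ρ, s ∈ R → s ∈ spanningSets ρ i →
      (∀ k, N₀ + N ≤ k → v (φ k) s ≤ C + 1 / ((j : ℝ) + 1)) → V s ≤ C + 1 / ((j : ℝ) + 1) by
    have h1 := ae_all_iff.2 fun j => ae_all_iff.2 fun N => ae_all_iff.2 fun i => hε j N i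
    filter_upwards [h1, hlim] with s hs hsl hsR
    obtain ⟨i, hi⟩ := mem_iUnion.1 ((iUnion_spanningSets ρ).symm ▸ mem_univ s)
    have hj : ∀ j : ℕ, V s ≤ C + 1 / ((j : ℝ) + 1) := by
      intro j
      have hpos : 0 < 1 / ((j : ℝ) + 1) := by positivity
      obtain ⟨N, hN⟩ := eventually_atTop.1
        ((hsl hsR).eventually_le_const (show C < C + 1 / ((j : ℝ) + 1) by linarith))
      exact hs j N i hsR hi fun k hk => hN k (by omega)
    have := tendsto_one_div_add_atTop_nhds_zero_nat (𝕜 := ℝ)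
    refine ge_of_tendsto' (x := atTop) (f := fun j : ℕ => C + 1 / ((j : ℝ) + 1)) ?_ hj
    simpa using this.const_add C
  intro j N i
  set K := C + 1 / ((j : ℝ) + 1) with hK
  set Q : Set S := {s | ∀ k, N₀ + N ≤ k → v (φ k) s ≤ K} with hQ
  -- Membership in `L²` gives only a.e. measurability, hence null measurability here and a
  -- measurable hull for the test function below.
  have hQm : NullMeasurableSet Q ρ := by
    have : Q = ⋂ k, ⋂ (_ : N₀ + N ≤ k), {s | v (φ k) s ≤ K} := by
      ext s; simp [hQ]
    rw [this]
    refine NullMeasurableSet.iInter fun k => NullMeasurableSet.iInter fun hk => ?_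
    exact nullMeasurableSet_le (hN₀ k (by omega)).aestronglyMeasurable.aemeasurable
      aemeasurable_const
  set G : Set S := Q ∩ (R ∩ spanningSets ρ i) with hG
  have hGm : NullMeasurableSet G ρ :=
    hQm.inter (hR.inter (measurableSet_spanningSets ρ i)).nullMeasurableSet
  have hGf : ρ G < ⊤ := (measure_mono (inter_subset_right.trans inter_subset_right)).trans_lt
    (measure_spanningSets_lt_top ρ i)
  have : IsFiniteMeasure (ρ.restrict G) := ⟨by rwa [Measure.restrict_apply_univ]⟩
  have hVi : Integrable V (ρ.restrict G) := h.2.1.restrict G |>.integrable (by norm_num)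
  have hae : V ≤ᵐ[ρ.restrict G] fun _ => K := by
    refine ae_le_of_forall_setIntegral_le hVi (integrable_const K) fun T hT _ => ?_
    have hTm : NullMeasurableSet (T ∩ G) ρ := hT.nullMeasurableSet.inter hGm
    have hTf : ρ (T ∩ G) ≠ ⊤ := ((measure_mono inter_subset_right).trans_lt hGf).ne
    rw [Measure.restrict_restrict hT]
    set T' := toMeasurable ρ (T ∩ G) with hT'
    have hT'm : MeasurableSet T' := measurableSet_toMeasurable _ _
    have hTT : T' =ᵐ[ρ] (T ∩ G : Set S) := hTm.toMeasurable_ae_eq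
    have hT'f : ρ T' ≠ ⊤ := by rwa [measure_toMeasurable]
    have hind : MemLp (T'.indicator fun _ => (1 : ℝ)) 2 ρ :=
      memLp_indicator_const 2 hT'm 1 (Or.inr hT'f)
    have hconv := (h.2.2 _ hind).comp hφ
    have e : ∀ f : S → ℝ, ∫ s, f s * T'.indicator (fun _ => (1 : ℝ)) s ∂ρ =
        ∫ s in T ∩ G, f s ∂ρ := fun f => by
      rw [← setIntegral_congr_set hTT, ← integral_indicator hT'm]
      refine integral_congr_ae (ae_of_all _ fun s => ?_)
      by_cases hs : s ∈ T' <;> simp [hs]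
    simp only [Function.comp_def, e] at hconv
    refine le_of_tendsto hconv ?_
    filter_upwards [eventually_ge_atTop (N₀ + N)] with k hk
    have : IsFiniteMeasure (ρ.restrict (T ∩ G)) :=
      ⟨by rw [Measure.restrict_apply_univ]; exact lt_top_iff_ne_top.2 hTf⟩
    refine integral_mono_ae (((hN₀ k (by omega)).restrict _).integrable (by norm_num))
      (integrable_const K) ?_
    filter_upwards [ae_restrict_mem₀ hTm] with s hs
    exact hs.2.1 k hk
  rw [EventuallyLE, ae_restrict_iff'₀ hGm] at hae
  filter_upwards [hae] with s hs h1 h2 h3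
  exact hs ⟨h3, h1, h2⟩

theorem WeaklyConvergesL2.ae_eq_of_tendsto {ρ : Measure S} [SigmaFinite ρ] {v : ℕ → S → ℝ}
    {V : S → ℝ} (h : WeaklyConvergesL2 ρ v V) {φ : ℕ → ℕ} (hφ : Tendsto φ atTop atTop)
    {R : Set S} (hR : MeasurableSet R) {C : ℝ}
    (hlim : ∀ᵐ s ∂ρ, s ∈ R → Tendsto (fun k => v (φ k) s) atTop (𝓝 C)) :
    ∀ᵐ s ∂ρ, s ∈ R → V s = C := by
  have h1 := h.ae_le_of_tendsto hφ hR hlim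
  have h2 := h.neg.ae_le_of_tendsto hφ hR (C := -C) (hlim.mono fun s hs hsR => (hs hsR).neg)
  filter_upwards [h1, h2] with s hs1 hs2 hsR
  exact le_antisymm (hs1 hsR) (neg_le_neg_iff.1 (hs2 hsR))

end WeakLimit

namespace MoralHazard

/-! ### Consistency across subsequences and the adjusted threshold. -/

section Main

variable {A X : Type*} [MeasurableSpace X] {M : MoralHazard A X}

theorem continuous_coe_apply (a : M.Deviation) :
    Continuous fun L : M.Score => (L a : EReal) :=
  continuous_coe_real_ereal.comp (continuous_apply a)

theorem isOpen_forall_lt [Finite A] (γ : M.Deviation → EReal) :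
    IsOpen {L : M.Score | ∀ a, γ a < L a} := by
  rw [ofPred_forall]
  exact isOpen_iInter_of_finite fun a => isOpen_lt continuous_const (continuous_coe_apply a)

theorem isOpen_exists_lt (γ : M.Deviation → EReal) :
    IsOpen {L : M.Score | ∃ a, L a < γ a} := by
  rw [ofPred_exists]
  exact isOpen_iUnion fun a => isOpen_lt (continuous_coe_apply a) continuous_const

theorem exists_lineMap_mem {U : Set M.Score} (hU : IsOpen U) {L : M.Score} (hL : L ∈ U)
    (z : M.Score) : ∃ t : ℝ, 0 < t ∧ t ≤ 1 ∧ (1 - t) • L + t • z ∈ U := by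
  have hc : Continuous fun t : ℝ => (1 - t) • L + t • z := by fun_prop
  have h0 : Tendsto (fun t : ℝ => (1 - t) • L + t • z) (𝓝[>] 0) (𝓝 L) := by
    refine Tendsto.mono_left ?_ nhdsWithin_le_nhds
    simpa using hc.tendsto 0
  obtain ⟨t, h1, h2⟩ := ((h0.eventually (hU.mem_nhds hL)).and
    (Ioc_mem_nhdsGT (zero_lt_one' ℝ))).exists
  exact ⟨t, h2.1, h2.2, h1⟩

/-- The deviation `a` is among the cheaper ones that are hardest to tell from the target. -/
def IsHardestToDetect (M : MoralHazard A X) (a : M.Deviation) : Prop :=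
  ∀ b : M.Deviation, M.c b < M.c M.target → -M.meanScore a a ≤ -M.meanScore b b

theorem Assumptions.isHardestToDetect (hM : M.Assumptions) {a : M.Deviation}
    (ha : ∀ a' : A, M.c a' < M.c M.target →
      InformationTheory.klDiv (M.μ a) (M.μ M.target) ≤
        InformationTheory.klDiv (M.μ a') (M.μ M.target)) : M.IsHardestToDetect a := by
  intro b hb
  have h := ha b hb
  rw [(hM.klDiv_deviation a).2, (hM.klDiv_deviation b).2] at h
  exact (ENNReal.ofReal_le_ofReal_iff (neg_pos.2 (hM.klDiv_deviation b).1).le).1 h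

variable [Fintype A] {ρ : Measure M.Score} {v : ℕ → M.Score → ℝ} {V : M.Score → ℝ}
  {l : ℕ → A → ℝ} {φ φ' : ℕ → ℕ} {γ γ' : M.Deviation → EReal}

namespace IsThreshold

theorem ae_eq_target [SigmaFinite ρ] (hM : M.Assumptions)
    (hl : M.AreMultipliers (fun n x => v n (M.score n x)) l) (hγ : M.IsThreshold l φ γ)
    (hint : M.Interpolates ρ v) (hweak : WeaklyConvergesL2 ρ v V) :
    ∀ᵐ L ∂ρ, (∀ a, γ a < L a) → V L = M.c M.target :=
  hweak.ae_eq_of_tendsto hγ.tendsto (isOpen_forall_lt γ).measurableSet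
    (hint.mono fun _ hL hLγ => hγ.tendsto_target hM hl hL hLγ)

theorem ae_eq_u_wmin [SigmaFinite ρ] (hM : M.Assumptions)
    (hl : M.AreMultipliers (fun n x => v n (M.score n x)) l) (hγ : M.IsThreshold l φ γ)
    (hint : M.Interpolates ρ v) (hweak : WeaklyConvergesL2 ρ v V) :
    ∀ᵐ L ∂ρ, (∃ a, L a < γ a) → V L = M.u M.wmin :=
  hweak.ae_eq_of_tendsto hγ.tendsto (isOpen_exists_lt γ).measurableSet
    (hint.mono fun _ hL hLγ => hγ.tendsto_u_wmin hM hl hL hLγ)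

/-- A score that is rewarded along one subsequence is not punished along another. -/
theorem le_of_forall_lt [SigmaFinite ρ] (hM : M.Assumptions) (hρ : ρ.support = M.scoreDomain)
    (hl : M.AreMultipliers (fun n x => v n (M.score n x)) l) (hγ : M.IsThreshold l φ γ)
    (hγ' : M.IsThreshold l φ' γ') (hint : M.Interpolates ρ v)
    (hweak : WeaklyConvergesL2 ρ v V) {L : M.Score} (hLD : L ∈ M.scoreDomain)
    (hL : ∀ a, γ a < L a) (a : M.Deviation) : γ' a ≤ L a := by
  by_contra! hLa
  rw [← hρ] at hLD
  -- The overlap is an open neighbourhood of a support point, yet on it `V` would a.e. equal both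
  -- `c(a*)` and `u(wmin)`.
  have hpos := (Measure.mem_support_iff_forall L).1 hLD
    ({L | ∀ a, γ a < L a} ∩ {L | ∃ a, L a < γ' a})
    (((isOpen_forall_lt γ).inter (isOpen_exists_lt γ')).mem_nhds ⟨hL, a, hLa⟩)
  refine hpos.ne' (measure_mono_null ?_ ((hγ.ae_eq_target hM hl hint hweak).and
    (hγ'.ae_eq_u_wmin hM hl hint hweak)))
  rintro L' ⟨h1, h2⟩ h3
  exact (hM.u_wmin_lt_c M.target).ne ((h3.2 h2).symm.trans (h3.1 h1))

/-- If `γ' a = L a`, a small step inside the score domain towards a point lower in coordinate `a`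
stays rewarded under `γ` but drops below `γ' a`. This is why `hLinf` is needed. -/
theorem forall_lt_of_forall_lt [SigmaFinite ρ] (hM : M.Assumptions)
    (hρ : ρ.support = M.scoreDomain)
    (hl : M.AreMultipliers (fun n x => v n (M.score n x)) l) (hγ : M.IsThreshold l φ γ)
    (hγ' : M.IsThreshold l φ' γ') (hint : M.Interpolates ρ v)
    (hweak : WeaklyConvergesL2 ρ v V) {L : M.Score} (hLD : L ∈ M.scoreDomain)
    (hL : ∀ a, γ a < L a)
    (hLinf : ∀ a : M.Deviation, M.c a < M.c M.target → ∃ z ∈ M.scoreDomain, z a < L a)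
    (a : M.Deviation) : γ' a < L a := by
  rcases (hM.cost_ne a a.2).lt_or_gt with ha | ha
  · refine lt_of_le_of_ne (hγ.le_of_forall_lt hM hρ hl hγ' hint hweak hLD hL a) fun heq => ?_
    obtain ⟨z, hz, hza⟩ := hLinf a ha
    obtain ⟨t, ht0, ht1, ht⟩ := exists_lineMap_mem (isOpen_forall_lt γ) hL z
    have hmem := M.convex_scoreDomain hLD hz (sub_nonneg.2 ht1) ht0.le (by ring)
    have h1 := hγ.le_of_forall_lt hM hρ hl hγ' hint hweak hmem ht a
    rw [heq, EReal.coe_le_coe_iff] at h1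
    simp only [Pi.add_apply, Pi.smul_apply, smul_eq_mul] at h1
    nlinarith
  · rw [hγ'.eq_bot hM hl ha]
    exact EReal.bot_lt_coe _

/-- The target's mean score is positive in every coordinate while `γ' ≤ 0`. If `L ≥ γ'` throughout,
a small step towards it would be strictly rewarded under `γ'` and still punished under `γ`. -/
theorem exists_lt_of_exists_lt [SigmaFinite ρ] (hM : M.Assumptions)
    (hρ : ρ.support = M.scoreDomain)
    (hl : M.AreMultipliers (fun n x => v n (M.score n x)) l) (hγ : M.IsThreshold l φ γ)
    (hγ' : M.IsThreshold l φ' γ') (hint : M.Interpolates ρ v)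
    (hweak : WeaklyConvergesL2 ρ v V) {L : M.Score} (hLD : L ∈ M.scoreDomain)
    (hL : ∃ a, L a < γ a) : ∃ a, L a < γ' a := by
  by_contra! hcon
  obtain ⟨t, ht0, ht1, ht⟩ := exists_lineMap_mem (isOpen_exists_lt γ) hL (M.meanScore M.target)
  have hmem := M.convex_scoreDomain hLD (hM.meanScore_mem M.target) (sub_nonneg.2 ht1) ht0.le
    (by ring)
  obtain ⟨a, ha⟩ := ht
  refine absurd ha (not_lt.2 (hγ'.le_of_forall_lt hM hρ hl hγ hint hweak hmem (fun b => ?_) a))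
  have hpos := hM.meanScore_target_pos b
  have h0 := hγ'.le_zero hM hl b
  have h1 := hcon b
  simp only [Pi.add_apply, Pi.smul_apply, smul_eq_mul]
  induction hb : γ' b with
  | bot => exact EReal.bot_lt_coe _
  | top => rw [hb] at h0; exact absurd h0 (by simp)
  | coe r =>
    rw [hb] at h0 h1
    rw [EReal.coe_le_coe_iff] at h1
    have h0' : r ≤ 0 := by exact_mod_cast h0
    rw [EReal.coe_lt_coe_iff]
    nlinarith

end IsThreshold

open Classical in
/-- The least upper bound of the rates `γ`, the lower end of the range of scores, and, for the
cheaper deviations that are hardest to detect, their mean score. Raising the rates in this way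
does not change the punishment region within the score domain. -/
noncomputable def adjustedThreshold (M : MoralHazard A X) (γ : M.Deviation → EReal)
    (a : M.Deviation) : EReal :=
  if M.c a < M.c M.target then
    max (max (γ a) (⨅ L ∈ M.scoreDomain, (L a : EReal)))
      (if M.IsHardestToDetect a then (M.meanScore a a : EReal) else ⊥)
  else ⊥

theorem adjustedThreshold_ne_top (hM : M.Assumptions) {w : ∀ n, (Fin n → X) → ℝ}
    (hl : M.AreMultipliers w l) (hγ : M.IsThreshold l φ γ) (a : M.Deviation) :
    M.adjustedThreshold γ a ≠ ⊤ := by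
  have h1 : γ a < ⊤ := (hγ.le_zero hM hl a).trans_lt EReal.zero_lt_top
  have h2 : (⨅ L ∈ M.scoreDomain, (L a : EReal)) < ⊤ :=
    (iInf₂_le _ (hM.meanScore_mem (a : A))).trans_lt (EReal.coe_lt_top _)
  refine ne_of_lt ?_
  unfold adjustedThreshold
  split_ifs
  · exact max_lt (max_lt h1 h2) (EReal.coe_lt_top _)
  · exact max_lt (max_lt h1 h2) bot_lt_top
  · exact bot_lt_top

theorem adjustedThreshold_eq (hM : M.Assumptions) {w : ∀ n, (Fin n → X) → ℝ}
    (hl : M.AreMultipliers w l) (hγ : M.IsThreshold l φ γ) {a : M.Deviation}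
    (hac : M.c a < M.c M.target) (ha : M.IsHardestToDetect a) :
    M.adjustedThreshold γ a = M.meanScore a a := by
  rw [adjustedThreshold, if_pos hac, if_pos ha]
  exact max_eq_right (max_le (hγ.le_meanScore hM hl ha) (iInf₂_le _ (hM.meanScore_mem (a : A))))

theorem forall_lt_of_adjustedThreshold_lt (hM : M.Assumptions) {w : ∀ n, (Fin n → X) → ℝ}
    (hl : M.AreMultipliers w l) (hγ : M.IsThreshold l φ γ) {L : M.Score}
    (hL : ∀ a, M.adjustedThreshold γ a < L a) : (∀ a, γ a < L a) ∧
      ∀ a : M.Deviation, M.c a < M.c M.target → ∃ z ∈ M.scoreDomain, z a < L a := by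
  refine ⟨fun a => ?_, fun a ha => ?_⟩
  · rcases (hM.cost_ne a a.2).lt_or_gt with ha | ha
    · have := hL a
      rw [adjustedThreshold, if_pos ha] at this
      exact ((le_max_left _ _).trans (le_max_left _ _)).trans_lt this
    · rw [hγ.eq_bot hM hl ha]
      exact EReal.bot_lt_coe _
  · have := hL a
    rw [adjustedThreshold, if_pos ha] at this
    have h := ((le_max_right _ _).trans (le_max_left _ _)).trans_lt this
    simp only [iInf_lt_iff, EReal.coe_lt_coe_iff, exists_prop] at h
    exact h

/-- No score in the domain lies below the infimum, and those below the mean score of a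
hardest-to-detect deviation are already punished by `lt_of_lt_meanScore`. -/
theorem exists_lt_of_lt_adjustedThreshold (hM : M.Assumptions) {w : ∀ n, (Fin n → X) → ℝ}
    (hl : M.AreMultipliers w l) (hγ : M.IsThreshold l φ γ) {L : M.Score}
    (hLD : L ∈ M.scoreDomain) (hL : ∃ a, L a < M.adjustedThreshold γ a) :
    ∃ a, L a < γ a := by
  obtain ⟨a, ha⟩ := hL
  unfold adjustedThreshold at ha
  split_ifs at ha with hac hd
  · rcases lt_max_iff.1 ha with h | h
    · rcases lt_max_iff.1 h with h | h
      · exact ⟨a, h⟩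
      · exact absurd h (not_lt.2 (iInf₂_le _ hLD))
    · obtain ⟨a', ha'⟩ := hγ.exists_meanScore_le hM hl hac
      exact ⟨a', hγ.lt_of_lt_meanScore hM hl hd ha' hLD (EReal.coe_lt_coe_iff.1 h)⟩
  · rcases lt_max_iff.1 ha with h | h
    · rcases lt_max_iff.1 h with h | h
      · exact ⟨a, h⟩
      · exact absurd h (not_lt.2 (iInf₂_le _ hLD))
    · exact absurd h not_lt_bot
  · exact absurd ha not_lt_bot

end Main

end MoralHazard

theorem proposition2 {A X : Type*} [Finite A] [MeasurableSpace X]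
    (M : MoralHazard A X) (hM : M.Assumptions)
    (ρ : Measure M.Score) [SigmaFinite ρ] (hρ : ρ.support = M.scoreDomain)
    (v : ℕ → M.Score → ℝ) (V : M.Score → ℝ)
    (hopt : ∀ᶠ n in atTop, M.IsOptimal (fun x : Fin n → X => v n (M.score n x)))
    (hint : M.Interpolates ρ v)
    (hweak : WeaklyConvergesL2 ρ v V) :
    ∃ γ : M.Deviation → EReal,
      (∀ a, γ a ≠ ⊤) ∧
      (∀ a : M.Deviation, M.c M.target < M.c a → γ a = ⊥) ∧
      (∀ᵐ L ∂ρ, (∀ a, γ a < (L a : EReal)) →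
        Tendsto (fun n => v n L) atTop (𝓝 (M.c M.target)) ∧ V L = M.c M.target) ∧
      (∀ᵐ L ∂ρ, (∃ a, (L a : EReal) < γ a) →
        Tendsto (fun n => v n L) atTop (𝓝 (M.u M.wmin)) ∧ V L = M.u M.wmin) ∧
      (∀ a : M.Deviation, M.c a < M.c M.target →
        (∀ a' : A, M.c a' < M.c M.target →
          InformationTheory.klDiv (M.μ a) (M.μ M.target) ≤
            InformationTheory.klDiv (M.μ a') (M.μ M.target)) →
        ∀ n : ℕ, 0 < n → γ a = ((∫ x, M.score n x a ∂(M.law n a) : ℝ) : EReal)) := by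
  have := Fintype.ofFinite A
  obtain ⟨l, hl⟩ := hM.exists_areMultipliers hopt
  have hl0 : ∀ᶠ n in atTop, ∀ a, 0 ≤ l n a := hl.mono fun n hn => hn.2.nonneg
  obtain ⟨ψ, γ, -, hγ⟩ := M.exists_isThreshold l hl0 tendsto_id
  have hD : ∀ᵐ L ∂ρ, L ∈ M.scoreDomain := hρ ▸ Measure.support_mem_ae
  refine ⟨M.adjustedThreshold γ, MoralHazard.adjustedThreshold_ne_top hM hl hγ, fun a ha => ?_,
    ?_, ?_, fun a ha hmin n hn => ?_⟩
  · rw [MoralHazard.adjustedThreshold, if_neg (not_lt.2 ha.le)]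
  · filter_upwards [hD, hint, hγ.ae_eq_target hM hl hint hweak] with L hLD hLint hLV hL
    obtain ⟨h1, h2⟩ := MoralHazard.forall_lt_of_adjustedThreshold_lt hM hl hγ hL
    -- Every subsequence has a further one with its own rates `γ'`, whose reward region contains `L`
    -- because that of `γ` does.
    refine ⟨tendsto_of_subseq_tendsto fun ns hns => ?_, hLV h1⟩
    obtain ⟨ψ', γ', -, hγ'⟩ := M.exists_isThreshold l hl0 hns
    exact ⟨ψ', hγ'.tendsto_target hM hl hLint
      (hγ.forall_lt_of_forall_lt hM hρ hl hγ' hint hweak hLD h1 h2)⟩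
  · filter_upwards [hD, hint, hγ.ae_eq_u_wmin hM hl hint hweak] with L hLD hLint hLV hL
    have h1 := MoralHazard.exists_lt_of_lt_adjustedThreshold hM hl hγ hLD hL
    refine ⟨tendsto_of_subseq_tendsto fun ns hns => ?_, hLV h1⟩
    obtain ⟨ψ', γ', -, hγ'⟩ := M.exists_isThreshold l hl0 hns
    exact ⟨ψ', hγ'.tendsto_u_wmin hM hl hLint
      (hγ.exists_lt_of_exists_lt hM hρ hl hγ' hint hweak hLD h1)⟩
  · rw [MoralHazard.adjustedThreshold_eq hM hl hγ ha (hM.isHardestToDetect hmin),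
      hM.integral_score a a hn]
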